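/- Let $\alpha\in(0,1)$, $p\in[1,2]$, $a_-,a_+,\lambda_-,\lambda_+>0$, and let $\ell^p(\mathbb N)$ be the Banach space of complex $p$-summable sequences $(z_n)_{n\ge 0}$, with canonical basis $(e_n)_{n\ge0}$. Let $(\omega_n)_{n\ge 0}$ be a bounded sequence of positive numbers, let $k_0>0$, put $k_n:=k_0\prod_{l=0}^{n-1}\omega_l^{-1}$ for $n\ge 1$, and assume that $\sum_{n\ge0}k_n^\alpha<\infty$. Let $\theta_{1,n},\theta_{2,n}$, $n\ge0$, be independent real random variables, all having the tempered stable law with characteristic function $$t\mapsto\exp\Big(\int_{\mathbb R}\big(e^{itx}-1-i\kappa(x)tx\big)\lambda(dx)\Big),\qquad \kappa(x)=\mathbf 1_{\{|x|<1\}}+\tfrac1{|x|}\mathbf 1_{\{|x|\ge1\}},$$ $$\lambda(dx)=a_-\frac{e^{-\lambda_-|x|}}{|x|^{1+\alpha}}\mathbf 1_{\{x<0\}}\,dx+a_+\frac{e^{-\lambda_+x}}{x^{1+\alpha}}\mathbf 1_{\{x>0\}}\,dx .$$ Then the random series $\sum_{n\ge0}k_n(\theta_{1,n}+i\theta_{2,n})e_n$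 converges almost surely in $\ell^p(\mathbb N)$ and defines (up to a null set) an $\ell^p(\mathbb N)$-valued random variable; let $\mu$ be its distribution. Let $T$ be the bounded weighted backward shift on $\ell^p(\mathbb N)$ with $Te_0=0$, $Te_{n+1}=\omega_ne_n$ for $n\ge0$, and let $T^*$ be its adjoint on the dual space, where the dual pairing is $\langle z,x^*\rangle=x^*(z)$. Let $(a_j)_{j\ge0},(b_l)_{l\ge0}$ be complex sequences with $\sum_j|a_j|<\infty$, $\sum_l|b_l|<\infty$ and $\sum_{j}|a_j|\,\|T\|^{jp/2}<\infty$. Let $\phi\neq\psi$ be two distinct functions among $\operatorname{Re},-\operatorname{Re},\operatorname{Im},-\operatorname{Im}$, let $x^*,y^*\in(\ell^p(\mathbb N))^*$, and set $$f(z):=\sum_{j=0}^\infty a_je^{i\phi(\langle z,T^{*j}x^*\rangle)},\qquad g(z):=\sum_{l=0}^\infty b_le^{i\psi(\langle z,T^{*l}y^*\rangle)} .$$ Then both series converge absolutely for every $z$, and $f,g\in L^2(\mu)$. If moreover $T$ is (strongly) mixing with respect to $\mu$, i.e. $\mu(A\cap T^{-n}B)\to\mu(A)\mu(B)$ as $n\to\infty$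 for all Borel sets $A,B$, then there is a constant $C>0$, not depending on $n$ (but possibly on $f,g,\mu,T$), such that $$I_n(f,g):=\int f(z)\,g(T^nz)\,\mu(dz)-\int f\,d\mu\int g\,d\mu$$ satisfies $$|I_n(f,g)|\le C\sum_{l=0}^\infty|b_l|\sum_{j=0}^\infty k_j^{p/2}k_{j+l+n}^{p/2}\qquad\text{for all } n\ge0 .$$ -/

import Mathlib

open MeasureTheory ProbabilityTheory Filter Topology
open scoped ENNReal

namespace TemperedShift

noncomputable section

/-- The space `ℓ^p(ℕ)` of complex sequences. -/
abbrev SeqSpace (p : ℝ≥0∞) : Type := lp (fun _ : ℕ => ℂ) p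

/-- The canonical basis vectors of `ℓ^p(ℕ)`. -/
def basisVec (p : ℝ≥0∞) (n : ℕ) : SeqSpace p := lp.single p n (1 : ℂ)

/-! ### Tempered stable laws on the real line -/

/-- The truncation function `κ(x) = 1` for `|x| < 1`, `κ(x) = 1/|x|` for `|x| ≥ 1`. -/
def truncKappa (x : ℝ) : ℝ := if |x| < 1 then 1 else 1 / |x|

/-- The density of the tempered stable Lévy measure:
`aNeg e^{-lNeg |x|} / |x|^{1+α}` for `x < 0` and `aPos e^{-lPos x} / x^{1+α}` for `x > 0`. -/
def levyDensity (α aNeg aPos lNeg lPos x : ℝ) : ℝ :=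
  if x < 0 then aNeg * Real.exp (-lNeg * |x|) / |x| ^ (1 + α)
  else if 0 < x then aPos * Real.exp (-lPos * x) / x ^ (1 + α)
  else 0

/-- The tempered stable Lévy measure on `ℝ`. -/
def levyMeasure (α aNeg aPos lNeg lPos : ℝ) : Measure ℝ :=
  volume.withDensity fun x => ENNReal.ofReal (levyDensity α aNeg aPos lNeg lPos x)

/-- The law `ν` is the (centered) tempered stable law: its characteristic function is
`t ↦ exp (∫ (e^{itx} - 1 - i κ(x) t x) λ(dx))`, with `λ` the tempered stable Lévy measure. -/
def IsTemperedStable (α aNeg aPos lNeg lPos : ℝ) (ν : Measure ℝ) : Prop :=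
  ∀ t : ℝ, charFun ν t =
    Complex.exp (∫ x : ℝ,
      (Complex.exp (Complex.I * t * x) - 1 - Complex.I * truncKappa x * t * x)
        ∂(levyMeasure α aNeg aPos lNeg lPos))

/-! ### The coefficients, the random series and its law -/

/-- `k_n = k_0 ∏_{l < n} 1 / w_l`. -/
def coeff (k₀ : ℝ) (w : ℕ → ℝ) (n : ℕ) : ℝ := k₀ * ∏ l ∈ Finset.range n, 1 / w l

/-- The `n`-th term `k_n (θ_{1,n} + i θ_{2,n}) e_n` of the random series
(`θ 0` and `θ 1` are the two sequences). -/
def seriesTerm {Ω : Type*} (p : ℝ≥0∞) (k : ℕ → ℝ) (θ : Fin 2 → ℕ → Ω → ℝ) (ω : Ω) (n : ℕ) :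
    SeqSpace p :=
  ((k n : ℂ) * ((θ 0 n ω : ℂ) + Complex.I * (θ 1 n ω : ℂ))) • basisVec p n

/-- The random series `∑_n k_n (θ_{1,n} + i θ_{2,n}) e_n` in `ℓ^p(ℕ)`. -/
def randomSeries {Ω : Type*} (p : ℝ≥0∞) [Fact (1 ≤ p)] (k : ℕ → ℝ) (θ : Fin 2 → ℕ → Ω → ℝ)
    (ω : Ω) : SeqSpace p :=
  ∑' n, seriesTerm p k θ ω n

/-! ### The weighted backward shift -/

theorem memℓp_shift {p : ℝ≥0∞} (w : ℕ → ℝ) {C : ℝ} (hw : ∀ n, |w n| ≤ C) (z : SeqSpace p) :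
    Memℓp (fun n => (w n : ℂ) * z (n + 1)) p := by
  have hC : 0 ≤ C := (abs_nonneg _).trans (hw 0)
  have hb : ∀ n, ‖(w n : ℂ) * z (n + 1)‖ ≤ C * ‖z (n + 1)‖ := fun n => by
    rw [norm_mul, Complex.norm_real, Real.norm_eq_abs]
    exact mul_le_mul_of_nonneg_right (hw n) (norm_nonneg _)
  rcases p.trichotomy with (rfl | rfl | hp)
  · have h := memℓp_zero_iff.1 (lp.memℓp z)
    refine memℓp_zero ((h.preimage ((add_left_injective 1).injOn)).subset ?_)
    intro n hn
    exact right_ne_zero_of_mul hn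
  · obtain ⟨B, hB⟩ := memℓp_infty_iff.1 (lp.memℓp z)
    refine memℓp_infty ⟨C * B, ?_⟩
    rintro _ ⟨n, rfl⟩
    exact (hb n).trans (mul_le_mul_of_nonneg_left (hB ⟨n + 1, rfl⟩) hC)
  · have h := (lp.memℓp z).summable hp
    refine memℓp_gen (Summable.of_nonneg_of_le (fun n => by positivity) (fun n => ?_)
      (((summable_nat_add_iff 1).2 h).mul_left (C ^ p.toReal)))
    rw [← Real.mul_rpow hC (norm_nonneg _)]
    exact Real.rpow_le_rpow (norm_nonneg _) (hb n) hp.le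

theorem norm_shift_le {p : ℝ≥0∞} [Fact (1 ≤ p)] (w : ℕ → ℝ) {C : ℝ} (hw : ∀ n, |w n| ≤ C)
    (z : SeqSpace p) :
    ‖(⟨fun n => (w n : ℂ) * z (n + 1), memℓp_shift w hw z⟩ : SeqSpace p)‖ ≤ C * ‖z‖ := by
  have hC : 0 ≤ C := (abs_nonneg _).trans (hw 0)
  have hb : ∀ n, ‖(w n : ℂ) * z (n + 1)‖ ≤ C * ‖z (n + 1)‖ := fun n => by
    rw [norm_mul, Complex.norm_real, Real.norm_eq_abs]
    exact mul_le_mul_of_nonneg_right (hw n) (norm_nonneg _)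
  have hp0 : p ≠ 0 := (zero_lt_one.trans_le (Fact.out : 1 ≤ p)).ne'
  rcases p.trichotomy with (rfl | rfl | hp)
  · exact absurd rfl hp0
  · refine lp.norm_le_of_forall_le (by positivity) fun n => ?_
    exact (hb n).trans (mul_le_mul_of_nonneg_left (lp.norm_apply_le_norm hp0 z (n + 1)) hC)
  · refine lp.norm_le_of_tsum_le hp (by positivity) ?_
    have h := (lp.memℓp z).summable hp
    have h1 := (summable_nat_add_iff 1).2 h
    rw [Real.mul_rpow hC (norm_nonneg _), lp.norm_rpow_eq_tsum hp z]
    calc ∑' n, ‖(w n : ℂ) * z (n + 1)‖ ^ p.toReal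
        ≤ ∑' n, C ^ p.toReal * ‖z (n + 1)‖ ^ p.toReal := by
          refine Summable.tsum_le_tsum (fun n => ?_) ((memℓp_shift w hw z).summable hp)
            (h1.mul_left _)
          rw [← Real.mul_rpow hC (norm_nonneg _)]
          exact Real.rpow_le_rpow (norm_nonneg _) (hb n) hp.le
      _ = C ^ p.toReal * ∑' n, ‖z (n + 1)‖ ^ p.toReal := tsum_mul_left
      _ ≤ C ^ p.toReal * ∑' n, ‖z n‖ ^ p.toReal := by
          refine mul_le_mul_of_nonneg_left ?_ (by positivity)
          rw [h.tsum_eq_zero_add]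
          exact le_add_of_nonneg_left (by positivity)

/-- The bounded weighted backward shift `(T z)_n = w_n z_{n+1}` on `ℓ^p(ℕ)`, for a bounded weight
sequence `w`. -/
def backwardShift (p : ℝ≥0∞) [Fact (1 ≤ p)] (w : ℕ → ℝ) (hw : ∃ C, ∀ n, |w n| ≤ C) :
    SeqSpace p →L[ℂ] SeqSpace p :=
  LinearMap.mkContinuousOfExistsBound
    { toFun := fun z => ⟨fun n => (w n : ℂ) * z (n + 1), memℓp_shift w hw.choose_spec z⟩
      map_add' := fun x y => by
        ext n
        exact mul_add (w n : ℂ) (x (n + 1)) (y (n + 1))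
      map_smul' := fun c x => by
        ext n
        exact mul_left_comm (w n : ℂ) c (x (n + 1)) }
    ⟨hw.choose, fun z => norm_shift_le w hw.choose_spec z⟩

theorem backwardShift_apply (p : ℝ≥0∞) [Fact (1 ≤ p)] (w : ℕ → ℝ) (hw : ∃ C, ∀ n, |w n| ≤ C)
    (z : SeqSpace p) (n : ℕ) : backwardShift p w hw z n = (w n : ℂ) * z (n + 1) := rfl

/-- `T e_0 = 0`. -/
theorem backwardShift_basisVec_zero (p : ℝ≥0∞) [Fact (1 ≤ p)] (w : ℕ → ℝ)
    (hw : ∃ C, ∀ n, |w n| ≤ C) : backwardShift p w hw (basisVec p 0) = 0 := by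
  ext n
  rw [backwardShift_apply]
  simp [basisVec]

/-- `T e_{n+1} = w_n e_n`. -/
theorem backwardShift_basisVec_succ (p : ℝ≥0∞) [Fact (1 ≤ p)] (w : ℕ → ℝ)
    (hw : ∃ C, ∀ n, |w n| ≤ C) (n : ℕ) :
    backwardShift p w hw (basisVec p (n + 1)) = (w n : ℂ) • basisVec p n := by
  ext m
  change (w m : ℂ) * basisVec p (n + 1) (m + 1) = (w n : ℂ) * basisVec p n m
  by_cases h : m = n
  · subst h
    simp [basisVec]
  · simp [basisVec, h]

/-! ### Mixing, exponential series and correlations -/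

section General

variable {E : Type*} [NormedAddCommGroup E] [NormedSpace ℂ E]

/-- The adjoint `T^* : E^* → E^*`, `⟨z, T^* x^*⟩ = ⟨T z, x^*⟩`, for the (bilinear) duality pairing
`⟨z, x^*⟩ = x^* z` of `E` with its continuous dual. -/
def dualOp (T : E →L[ℂ] E) : StrongDual ℂ E →L[ℂ] StrongDual ℂ E :=
  ContinuousLinearMap.precomp ℂ T

/-- The term `a_j exp (i φ(⟨z, T^{*j} x^*⟩))`. -/
def expTerm (T : E →L[ℂ] E) (φ : ℂ → ℝ) (a : ℕ → ℂ) (xs : StrongDual ℂ E) (z : E) (j : ℕ) : ℂ :=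
  a j * Complex.exp (Complex.I * (φ (((dualOp T ^ j) xs) z) : ℂ))

/-- The exponential series `z ↦ ∑_j a_j exp (i φ(⟨z, T^{*j} x^*⟩))`. -/
def expSeries (T : E →L[ℂ] E) (φ : ℂ → ℝ) (a : ℕ → ℂ) (xs : StrongDual ℂ E) (z : E) : ℂ :=
  ∑' j, expTerm T φ a xs z j

variable [MeasurableSpace E]

/-- Strong mixing of the map `T` under `μ`: `μ (A ∩ T⁻ⁿ B) → μ A * μ B` for all measurable `A`, `B`.
The invariance of `μ`, which usually accompanies this notion, is not asked for here. -/
def IsStronglyMixing (T : E →L[ℂ] E) (μ : Measure E) : Prop :=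
  ∀ A B : Set E, MeasurableSet A → MeasurableSet B →
    Tendsto (fun n : ℕ => μ (A ∩ (fun z => (T ^ n) z) ⁻¹' B)) atTop (𝓝 (μ A * μ B))

/-- `I_n(f, g) = ∫ f(z) g(Tⁿ z) μ(dz) - ∫ f dμ ∫ g dμ`. -/
def correlation (T : E →L[ℂ] E) (μ : Measure E) (n : ℕ) (f g : E → ℂ) : ℂ :=
  (∫ z, f z * g ((T ^ n) z) ∂μ) - (∫ z, f z ∂μ) * ∫ z, g z ∂μ

end General

/-- The four functions `Re, -Re, Im, -Im`. -/
def partFunctions : Set (ℂ → ℝ) :=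
  {fun z => z.re, fun z => -z.re, fun z => z.im, fun z => -z.im}

end

end TemperedShift

open TemperedShift

/-!
Write `T` for the shift, `ζ_n = θ_{1,n} + i θ_{2,n}` and `Z = ∑ k_n ζ_n e_n`. Since
`w_n k_{n+1} = k_n`, the image `T Z` is the same series built on the shifted sequence `(ζ_{n+1})`,
so `μ` is `T`-invariant and the correlation is a genuine covariance. A functional of `Z` is a sum
of independent variables, and a covariance of two exponentials of such sums telescopes, one
coordinate at a time. The coordinate `n` contributes at most the covariance of `e^{iX}` and `e^{iY}`
with `|X| ≲ k_n |ζ_n|` and `|Y| ≲ k_{n-N} |ζ_n|`; as `|e^{iX} - 1| ≤ 2 |X|^{p/2}`, this is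
`O((k_n k_{n-N})^{p/2} E|ζ_0|^p)`. The moment is finite because the characteristic function of a
tempered stable law is `1 + O(t²)` in its real part at the origin, which forces a second moment.
-/

namespace TemperedShift

/-! ### Covariances of complex functions -/

section Covariance

variable {Ω : Type*} [MeasurableSpace Ω] {P : Measure Ω}

/-- The bilinear covariance `∫ F G - ∫ F ∫ G` of two complex functions. There is no conjugation, so
that `correlation T μ n f g` is the covariance of `f` and `g ∘ Tⁿ` when `T` preserves `μ`. -/
noncomputable def bilinCov (P : Measure Ω) (F G : Ω → ℂ) : ℂ :=
  (∫ ω, F ω * G ω ∂P) - (∫ ω, F ω ∂P) * ∫ ω, G ω ∂P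

theorem bilinCov_comm (F G : Ω → ℂ) : bilinCov P F G = bilinCov P G F := by
  simp only [bilinCov, mul_comm]

theorem bilinCov_const_mul (c : ℂ) (F G : Ω → ℂ) :
    bilinCov P (fun ω => c * F ω) G = c * bilinCov P F G := by
  simp only [bilinCov, mul_assoc, integral_const_mul, mul_sub]

theorem bilinCov_sub_const_left [IsProbabilityMeasure P] {F G : Ω → ℂ} (hF : Integrable F P)
    (hG : Integrable G P) (hFG : Integrable (fun ω => F ω * G ω) P) (c : ℂ) :
    bilinCov P (fun ω => F ω - c) G = bilinCov P F G := by
  simp only [bilinCov, sub_mul]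
  rw [integral_sub hFG (hG.const_mul c), integral_sub hF (integrable_const c), integral_const_mul,
    integral_const, probReal_univ, one_smul]
  ring

theorem bilinCov_sub_const [IsProbabilityMeasure P] {F G : Ω → ℂ} (hF : Integrable F P)
    (hG : Integrable G P) (hFG : Integrable (fun ω => F ω * G ω) P) (c d : ℂ) :
    bilinCov P (fun ω => F ω - c) (fun ω => G ω - d) = bilinCov P F G := by
  have hFGd : Integrable (fun ω => F ω * (G ω - d)) P := by
    simp only [mul_sub]
    exact hFG.sub (hF.mul_const d)
  calc bilinCov P (fun ω => F ω - c) (fun ω => G ω - d) = bilinCov P F (fun ω => G ω - d) :=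
        bilinCov_sub_const_left hF (hG.sub (integrable_const d)) hFGd c
    _ = bilinCov P (fun ω => G ω - d) F := bilinCov_comm _ _
    _ = bilinCov P G F := bilinCov_sub_const_left hG hF (by simpa only [mul_comm] using hFG) d
    _ = bilinCov P F G := bilinCov_comm _ _

theorem bilinCov_map {E : Type*} [MeasurableSpace E] {Z : Ω → E} (hZ : AEMeasurable Z P)
    {F G : E → ℂ} (hF : Measurable F) (hG : Measurable G) :
    bilinCov (P.map Z) F G = bilinCov P (fun ω => F (Z ω)) (fun ω => G (Z ω)) := by
  rw [bilinCov, integral_map (f := fun z => F z * G z) hZ (hF.mul hG).aestronglyMeasurable,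
    integral_map hZ hF.aestronglyMeasurable, integral_map hZ hG.aestronglyMeasurable, bilinCov]

theorem hasSum_bilinCov [IsFiniteMeasure P] {ι : Type*} [Countable ι] {F : ι → Ω → ℂ} {G : Ω → ℂ}
    {c : ι → ℝ} {C : ℝ} (hF : ∀ j, AEStronglyMeasurable (F j) P) (hG : AEStronglyMeasurable G P)
    (hFc : ∀ j ω, ‖F j ω‖ ≤ c j) (hGC : ∀ ω, ‖G ω‖ ≤ C) (hc : Summable c) :
    HasSum (fun j => bilinCov P (F j) G) (bilinCov P (fun ω => ∑' j, F j ω) G) := by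
  have hsum : ∀ ω, HasSum (fun j => F j ω) (∑' j, F j ω) := fun ω =>
    (Summable.of_norm_bounded hc fun j => hFc j ω).hasSum
  have hFG : HasSum (fun j => ∫ ω, F j ω * G ω ∂P) (∫ ω, (∑' j, F j ω) * G ω ∂P) := by
    refine hasSum_integral_of_dominated_convergence (fun j _ => c j * C) (fun j => (hF j).mul hG)
      (fun j => ae_of_all _ fun ω => ?_) (ae_of_all _ fun _ => hc.mul_right C)
      (integrable_const _) (ae_of_all _ fun ω => (hsum ω).mul_right (G ω))
    rw [norm_mul]
    exact mul_le_mul (hFc j ω) (hGC ω) (norm_nonneg _) ((norm_nonneg _).trans (hFc j ω))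
  exact hFG.sub ((hasSum_integral_of_dominated_convergence (fun j _ => c j) hF
    (fun j => ae_of_all _ (hFc j)) (ae_of_all _ fun _ => hc) (integrable_const _)
    (ae_of_all _ hsum)).mul_right _)

theorem norm_bilinCov_le_of_norm_le [IsProbabilityMeasure P] {F G : Ω → ℂ} {H : Ω → ℝ} {A B : ℝ}
    (hA : 0 ≤ A) (hB : 0 ≤ B) (hH : MemLp H 2 P) (hF : ∀ ω, ‖F ω‖ ≤ A * H ω)
    (hG : ∀ ω, ‖G ω‖ ≤ B * H ω) : ‖bilinCov P F G‖ ≤ 2 * (A * B) * ∫ ω, H ω ^ 2 ∂P := by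
  have hHi : Integrable H P := hH.integrable one_le_two
  have hmul : ‖∫ ω, F ω * G ω ∂P‖ ≤ A * B * ∫ ω, H ω ^ 2 ∂P := by
    rw [← integral_const_mul]
    refine norm_integral_le_of_norm_le (hH.integrable_sq.const_mul _) (ae_of_all _ fun ω => ?_)
    rw [norm_mul]
    calc ‖F ω‖ * ‖G ω‖ ≤ A * H ω * (B * H ω) :=
          mul_le_mul (hF ω) (hG ω) (norm_nonneg _) ((norm_nonneg _).trans (hF ω))
      _ = A * B * H ω ^ 2 := by ring
  have hF' : ‖∫ ω, F ω ∂P‖ ≤ A * ∫ ω, H ω ∂P := by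
    rw [← integral_const_mul]
    exact norm_integral_le_of_norm_le (hHi.const_mul A) (ae_of_all _ hF)
  have hG' : ‖∫ ω, G ω ∂P‖ ≤ B * ∫ ω, H ω ∂P := by
    rw [← integral_const_mul]
    exact norm_integral_le_of_norm_le (hHi.const_mul B) (ae_of_all _ hG)
  have hjensen : (∫ ω, H ω ∂P) ^ 2 ≤ ∫ ω, H ω ^ 2 ∂P := by
    have := variance_nonneg H P
    rw [variance_eq_sub hH] at this
    simpa using this
  calc ‖bilinCov P F G‖ ≤ ‖∫ ω, F ω * G ω ∂P‖ + ‖∫ ω, F ω ∂P‖ * ‖∫ ω, G ω ∂P‖ :=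
        (norm_sub_le _ _).trans_eq (by rw [norm_mul])
    _ ≤ A * B * ∫ ω, H ω ^ 2 ∂P + A * (∫ ω, H ω ∂P) * (B * ∫ ω, H ω ∂P) :=
        add_le_add hmul (mul_le_mul hF' hG' (norm_nonneg _) ((norm_nonneg _).trans hF'))
    _ = A * B * ∫ ω, H ω ^ 2 ∂P + A * B * (∫ ω, H ω ∂P) ^ 2 := by ring
    _ ≤ A * B * ∫ ω, H ω ^ 2 ∂P + A * B * ∫ ω, H ω ^ 2 ∂P := by gcongr
    _ = 2 * (A * B) * ∫ ω, H ω ^ 2 ∂P := by ring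

theorem norm_prod_sub_prod_le_sum {ι R : Type*} [NormedCommRing R] [NormMulClass R]
    [NormOneClass R] (s : Finset ι) {u v : ι → R} (hu : ∀ q, ‖u q‖ ≤ 1) (hv : ∀ q, ‖v q‖ ≤ 1) :
    ‖∏ q ∈ s, u q - ∏ q ∈ s, v q‖ ≤ ∑ q ∈ s, ‖u q - v q‖ := by
  classical
  induction s using Finset.induction_on with
  | empty => simp
  | insert a s ha ih =>
    rw [Finset.prod_insert ha, Finset.prod_insert ha, Finset.sum_insert ha]
    have hprod : ‖∏ q ∈ s, u q‖ ≤ 1 := by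
      rw [norm_prod]
      exact Finset.prod_le_one (fun _ _ => norm_nonneg _) fun q _ => hu q
    calc ‖u a * ∏ q ∈ s, u q - v a * ∏ q ∈ s, v q‖
        = ‖(u a - v a) * ∏ q ∈ s, u q + v a * (∏ q ∈ s, u q - ∏ q ∈ s, v q)‖ := by
          congr 1; ring
      _ ≤ ‖u a - v a‖ * ‖∏ q ∈ s, u q‖ + ‖v a‖ * ‖∏ q ∈ s, u q - ∏ q ∈ s, v q‖ := by
          simpa only [norm_mul] using norm_add_le ((u a - v a) * ∏ q ∈ s, u q)
            (v a * (∏ q ∈ s, u q - ∏ q ∈ s, v q))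
      _ ≤ ‖u a - v a‖ * 1 + 1 * ∑ q ∈ s, ‖u q - v q‖ := by
          gcongr
          exact hv a
      _ = ‖u a - v a‖ + ∑ q ∈ s, ‖u q - v q‖ := by ring

theorem norm_bilinCov_prod_le_sum [IsProbabilityMeasure P] {ι : Type*} [Fintype ι]
    {F G : ι → Ω → ℂ} (hF : ∀ q, AEMeasurable (F q) P) (hG : ∀ q, AEMeasurable (G q) P)
    (hF1 : ∀ q ω, ‖F q ω‖ ≤ 1) (hG1 : ∀ q ω, ‖G q ω‖ ≤ 1)
    (hind : iIndepFun (fun q ω => (F q ω, G q ω)) P) :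
    ‖bilinCov P (fun ω => ∏ q, F q ω) (fun ω => ∏ q, G q ω)‖ ≤
      ∑ q, ‖bilinCov P (F q) (G q)‖ := by
  have hle1 : ∀ {H : Ω → ℂ}, (∀ ω, ‖H ω‖ ≤ 1) → ‖∫ ω, H ω ∂P‖ ≤ 1 := fun h =>
    (norm_integral_le_of_norm_le_const (ae_of_all _ h)).trans_eq (by simp)
  have hFG1 : ∀ q ω, ‖F q ω * G q ω‖ ≤ 1 := fun q ω => by
    rw [norm_mul]
    exact mul_le_one₀ (hF1 q ω) (norm_nonneg _) (hG1 q ω)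
  have hFG : ∫ ω, ∏ q, F q ω * G q ω ∂P = ∏ q, ∫ ω, F q ω * G q ω ∂P :=
    (hind.comp (fun _ z => z.1 * z.2)
      fun _ => measurable_fst.mul measurable_snd).integral_fun_prod_eq_prod_integral
        fun q => ((hF q).mul (hG q)).aestronglyMeasurable
  have hFprod : ∫ ω, ∏ q, F q ω ∂P = ∏ q, ∫ ω, F q ω ∂P :=
    (hind.comp (fun _ z => z.1) fun _ => measurable_fst).integral_fun_prod_eq_prod_integral
      fun q => (hF q).aestronglyMeasurable
  have hGprod : ∫ ω, ∏ q, G q ω ∂P = ∏ q, ∫ ω, G q ω ∂P :=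
    (hind.comp (fun _ z => z.2) fun _ => measurable_snd).integral_fun_prod_eq_prod_integral
      fun q => (hG q).aestronglyMeasurable
  simp only [bilinCov, ← Finset.prod_mul_distrib]
  rw [hFG, hFprod, hGprod, ← Finset.prod_mul_distrib]
  refine norm_prod_sub_prod_le_sum _ (fun q => hle1 (hFG1 q)) fun q => ?_
  rw [norm_mul]
  exact mul_le_one₀ (hle1 (hF1 q)) (norm_nonneg _) (hle1 (hG1 q))

theorem tendsto_bilinCov [IsFiniteMeasure P] {F G : ℕ → Ω → ℂ} {F' G' : Ω → ℂ}
    (hF : ∀ n, AEStronglyMeasurable (F n) P) (hG : ∀ n, AEStronglyMeasurable (G n) P)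
    (hF1 : ∀ n ω, ‖F n ω‖ ≤ 1) (hG1 : ∀ n ω, ‖G n ω‖ ≤ 1)
    (hFlim : ∀ᵐ ω ∂P, Tendsto (F · ω) atTop (𝓝 (F' ω)))
    (hGlim : ∀ᵐ ω ∂P, Tendsto (G · ω) atTop (𝓝 (G' ω))) :
    Tendsto (fun n => bilinCov P (F n) (G n)) atTop (𝓝 (bilinCov P F' G')) := by
  have hlim : ∀ {H : ℕ → Ω → ℂ} {H' : Ω → ℂ}, (∀ n, AEStronglyMeasurable (H n) P) →
      (∀ n ω, ‖H n ω‖ ≤ 1) → (∀ᵐ ω ∂P, Tendsto (H · ω) atTop (𝓝 (H' ω))) →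
      Tendsto (fun n => ∫ ω, H n ω ∂P) atTop (𝓝 (∫ ω, H' ω ∂P)) := fun hH hH1 h =>
    tendsto_integral_of_dominated_convergence (fun _ => (1 : ℝ)) hH (integrable_const _)
      (fun n => ae_of_all _ (hH1 n)) h
  refine (hlim (fun n => (hF n).mul (hG n)) (fun n ω => ?_) ?_).sub
    ((hlim hF hF1 hFlim).mul (hlim hG hG1 hGlim))
  · rw [Pi.mul_apply, norm_mul]
    exact mul_le_one₀ (hF1 n ω) (norm_nonneg _) (hG1 n ω)
  · filter_upwards [hFlim, hGlim] with ω hFω hGω using hFω.mul hGω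

end Covariance

/-! ### Decorrelation of exponentials of independent sums -/

/-- The character `x ↦ e^{ix}` of the real line, the building block of `expTerm`. -/
noncomputable def expI (x : ℝ) : ℂ := Complex.exp (Complex.I * x)

theorem continuous_expI : Continuous expI := by
  unfold expI
  fun_prop

theorem norm_expI (x : ℝ) : ‖expI x‖ = 1 := Complex.norm_exp_I_mul_ofReal x

theorem expI_sum {ι : Type*} (s : Finset ι) (x : ι → ℝ) :
    expI (∑ q ∈ s, x q) = ∏ q ∈ s, expI (x q) := by
  simp only [expI, Complex.ofReal_sum, Finset.mul_sum, Complex.exp_sum]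

theorem norm_expI_sub_one_le {ρ : ℝ} (hρ : 0 ≤ ρ) (hρ1 : ρ ≤ 1) (x : ℝ) :
    ‖expI x - 1‖ ≤ 2 * |x| ^ ρ := by
  rcases le_total |x| 1 with h | h
  · calc ‖expI x - 1‖ ≤ |x| := Real.norm_exp_I_mul_ofReal_sub_one_le
      _ ≤ |x| ^ ρ := Real.self_le_rpow_of_le_one (abs_nonneg x) h hρ1
      _ ≤ 2 * |x| ^ ρ := le_mul_of_one_le_left (by positivity) one_le_two
  · calc ‖expI x - 1‖ ≤ ‖expI x‖ + ‖(1 : ℂ)‖ := norm_sub_le _ _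
      _ = 2 := by rw [norm_expI, norm_one]; norm_num
      _ ≤ 2 * |x| ^ ρ := le_mul_of_one_le_right zero_le_two (Real.one_le_rpow h hρ)

section Decorrelation

variable {Ω : Type*} [MeasurableSpace Ω] {P : Measure Ω} [IsProbabilityMeasure P]

theorem integrable_expI {X : Ω → ℝ} (hX : AEMeasurable X P) : Integrable (fun ω => expI (X ω)) P :=
  .of_bound (continuous_expI.measurable.comp_aemeasurable hX).aestronglyMeasurable 1
    (ae_of_all _ fun _ => (norm_expI _).le)

theorem norm_bilinCov_expI_le {E : Type*} [NormedAddCommGroup E] {X Y : Ω → ℝ} {ζ : Ω → E}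
    {ρ A B : ℝ} (hρ : 0 < ρ) (hρ1 : ρ ≤ 1) (hA : 0 ≤ A) (hB : 0 ≤ B) (hX : AEMeasurable X P)
    (hY : AEMeasurable Y P) (hζ : MemLp ζ (ENNReal.ofReal (2 * ρ)) P)
    (hXA : ∀ ω, |X ω| ≤ A * ‖ζ ω‖) (hYB : ∀ ω, |Y ω| ≤ B * ‖ζ ω‖) :
    ‖bilinCov P (fun ω => expI (X ω)) (fun ω => expI (Y ω))‖ ≤
      8 * (∫ ω, ‖ζ ω‖ ^ (2 * ρ) ∂P) * (A * B) ^ ρ := by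
  have hbound : ∀ {D : ℝ} {x : ℝ} {ω : Ω}, 0 ≤ D → |x| ≤ D * ‖ζ ω‖ →
      ‖expI x - 1‖ ≤ 2 * D ^ ρ * ‖ζ ω‖ ^ ρ := fun {D x ω} hD hx => by
    rw [mul_assoc, ← Real.mul_rpow hD (norm_nonneg _)]
    exact (norm_expI_sub_one_le hρ.le hρ1 x).trans (by gcongr)
  have hH : MemLp (fun ω => ‖ζ ω‖ ^ ρ) 2 P := by
    have := hζ.norm_rpow_div (ENNReal.ofReal ρ)
    rwa [ENNReal.toReal_ofReal hρ.le, ← ENNReal.ofReal_div_of_pos hρ,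
      mul_div_cancel_right₀ _ hρ.ne', ENNReal.ofReal_ofNat] at this
  have hXY : Integrable (fun ω => expI (X ω) * expI (Y ω)) P :=
    (integrable_expI hX).mul_bdd (integrable_expI hY).aestronglyMeasurable
      (ae_of_all _ fun _ => (norm_expI _).le)
  rw [← bilinCov_sub_const (integrable_expI hX) (integrable_expI hY) hXY 1 1]
  refine (norm_bilinCov_le_of_norm_le (by positivity) (by positivity) hH
    (fun ω => hbound hA (hXA ω)) fun ω => hbound hB (hYB ω)).trans_eq ?_
  simp only [mul_comm (2 : ℝ) ρ, Real.rpow_mul (norm_nonneg _), Real.rpow_two]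
  rw [Real.mul_rpow hA hB]
  ring

theorem norm_bilinCov_expI_le_of_hasSum {X Y : ℕ → Ω → ℝ} {S S' : Ω → ℝ} {d : ℕ → ℝ} {D : ℝ}
    (hX : ∀ n, AEMeasurable (X n) P) (hY : ∀ n, AEMeasurable (Y n) P)
    (hind : iIndepFun (fun n ω => (X n ω, Y n ω)) P)
    (hS : ∀ᵐ ω ∂P, HasSum (X · ω) (S ω)) (hS' : ∀ᵐ ω ∂P, HasSum (Y · ω) (S' ω))
    (hXY : ∀ n, ‖bilinCov P (fun ω => expI (X n ω)) (fun ω => expI (Y n ω))‖ ≤ d n)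
    (hd : HasSum d D) :
    ‖bilinCov P (fun ω => expI (S ω)) (fun ω => expI (S' ω))‖ ≤ D := by
  have hpartial : ∀ {U : ℕ → Ω → ℝ}, (∀ n, AEMeasurable (U n) P) → ∀ n,
      AEStronglyMeasurable (fun ω => expI (∑ q ∈ Finset.range n, U q ω)) P := fun hU n =>
    (integrable_expI (Finset.aemeasurable_fun_sum _ fun q _ => hU q)).aestronglyMeasurable
  have hlim : ∀ {U : ℕ → Ω → ℝ} {V : Ω → ℝ}, (∀ᵐ ω ∂P, HasSum (U · ω) (V ω)) → ∀ᵐ ω ∂P,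
      Tendsto (fun n => expI (∑ q ∈ Finset.range n, U q ω)) atTop (𝓝 (expI (V ω))) := fun hU =>
    hU.mono fun ω hω => (continuous_expI.tendsto _).comp hω.tendsto_sum_nat
  refine le_of_tendsto (tendsto_bilinCov (hpartial hX) (hpartial hY) (fun _ _ => (norm_expI _).le)
    (fun _ _ => (norm_expI _).le) (hlim hS) (hlim hS')).norm (Eventually.of_forall fun n => ?_)
  have hpairs : iIndepFun (fun (q : Fin n) ω => (expI (X q ω), expI (Y q ω))) P :=
    (hind.precomp Fin.val_injective).comp (fun _ z => (expI z.1, expI z.2)) fun _ => by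
      have := continuous_expI.measurable
      fun_prop
  simp only [Finset.sum_range, expI_sum]
  calc _ ≤ ∑ q : Fin n, ‖bilinCov P (fun ω => expI (X q ω)) (fun ω => expI (Y q ω))‖ :=
        norm_bilinCov_prod_le_sum (fun q => (integrable_expI (hX q)).aemeasurable)
          (fun q => (integrable_expI (hY q)).aemeasurable) (fun _ _ => (norm_expI _).le)
          (fun _ _ => (norm_expI _).le) hpairs
    _ ≤ ∑ q : Fin n, d q := Finset.sum_le_sum fun q _ => hXY q
    _ = ∑ q ∈ Finset.range n, d q := (Finset.sum_range d).symm
    _ ≤ D := sum_le_hasSum _ (fun q _ => (norm_nonneg _).trans (hXY q)) hd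

end Decorrelation

/-! ### Coefficients and weighted series -/

section Coefficients

theorem coeff_nonneg {k₀ : ℝ} {w : ℕ → ℝ} (hk₀ : 0 ≤ k₀) (hw : ∀ n, 0 ≤ w n) (n : ℕ) :
    0 ≤ coeff k₀ w n :=
  mul_nonneg hk₀ (Finset.prod_nonneg fun l _ => one_div_nonneg.2 (hw l))

theorem coeff_succ_mul {k₀ : ℝ} {w : ℕ → ℝ} (hw : ∀ n, w n ≠ 0) (n : ℕ) :
    coeff k₀ w (n + 1) * w n = coeff k₀ w n := by
  rw [coeff, Finset.prod_range_succ, ← mul_assoc, mul_assoc, one_div_mul_cancel (hw n), mul_one,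
    coeff]

variable {k : ℕ → ℝ}

theorem summable_rpow_of_le {α r : ℝ} (hk0 : ∀ n, 0 ≤ k n) (hα : 0 < α) (hr : α ≤ r)
    (hk : Summable fun n => k n ^ α) : Summable fun n => k n ^ r := by
  have hmem : ∀ {q : ℝ}, 0 < q → (Memℓp k (ENNReal.ofReal q) ↔ Summable fun n => k n ^ q) :=
    fun {q} hq => by
      rw [memℓp_gen_iff (by rwa [ENNReal.toReal_ofReal hq.le])]
      simp only [Real.norm_of_nonneg (hk0 _), ENNReal.toReal_ofReal hq.le]
  exact (hmem (hα.trans_le hr)).1 (((hmem hα).2 hk).of_exponent_ge (ENNReal.ofReal_le_ofReal hr))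

variable {ρ : ℝ}

theorem rpow_mul_rpow_le {x y : ℝ} (hx : 0 ≤ x) (hy : 0 ≤ y) :
    x ^ ρ * y ^ ρ ≤ (x ^ (2 * ρ) + y ^ (2 * ρ)) / 2 := by
  rw [mul_comm 2 ρ, Real.rpow_mul hx, Real.rpow_mul hy, Real.rpow_two, Real.rpow_two]
  linarith [two_mul_le_add_sq (x ^ ρ) (y ^ ρ)]

theorem summable_rpow_mul_rpow_add (hk0 : ∀ n, 0 ≤ k n) (hk : Summable fun n => k n ^ (2 * ρ))
    (N : ℕ) : Summable fun m => k m ^ ρ * k (m + N) ^ ρ :=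
  Summable.of_nonneg_of_le
    (fun _ => mul_nonneg (Real.rpow_nonneg (hk0 _) _) (Real.rpow_nonneg (hk0 _) _))
    (fun m => rpow_mul_rpow_le (hk0 m) (hk0 (m + N)))
    ((hk.add ((summable_nat_add_iff (f := fun n => k n ^ (2 * ρ)) N).2 hk)).div_const 2)

theorem tsum_rpow_mul_rpow_add_le (hk0 : ∀ n, 0 ≤ k n) (hk : Summable fun n => k n ^ (2 * ρ))
    (N : ℕ) : ∑' m, k m ^ ρ * k (m + N) ^ ρ ≤ ∑' m, k m ^ (2 * ρ) := by
  have hkN := (summable_nat_add_iff (f := fun n => k n ^ (2 * ρ)) N).2 hk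
  have htail : ∑' m, k (m + N) ^ (2 * ρ) ≤ ∑' m, k m ^ (2 * ρ) := by
    rw [← hk.sum_add_tsum_nat_add N]
    exact le_add_of_nonneg_left (Finset.sum_nonneg fun n _ => Real.rpow_nonneg (hk0 n) _)
  calc ∑' m, k m ^ ρ * k (m + N) ^ ρ ≤ ∑' m, (k m ^ (2 * ρ) + k (m + N) ^ (2 * ρ)) / 2 :=
        (summable_rpow_mul_rpow_add hk0 hk N).tsum_le_tsum
          (fun m => rpow_mul_rpow_le (hk0 m) (hk0 (m + N))) ((hk.add hkN).div_const 2)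
    _ = (∑' m, k m ^ (2 * ρ) + ∑' m, k (m + N) ^ (2 * ρ)) / 2 := by
        rw [tsum_div_const, hk.tsum_add hkN]
    _ ≤ ∑' m, k m ^ (2 * ρ) := by linarith

theorem tsum_rpow_mul_rpow_nonneg (hk0 : ∀ n, 0 ≤ k n) (τ : ℕ → ℕ) :
    0 ≤ ∑' m, k m ^ ρ * k (τ m) ^ ρ :=
  tsum_nonneg fun _ => mul_nonneg (Real.rpow_nonneg (hk0 _) _) (Real.rpow_nonneg (hk0 _) _)

theorem summable_norm_mul_tsum_rpow_mul_rpow_add {E : Type*} [SeminormedAddCommGroup E]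
    {b : ℕ → E} (hb : Summable fun l => ‖b l‖) (hk0 : ∀ n, 0 ≤ k n)
    (hk : Summable fun n => k n ^ (2 * ρ)) (N : ℕ) :
    Summable fun l => ‖b l‖ * ∑' m, k m ^ ρ * k (m + (l + N)) ^ ρ :=
  (hb.mul_right (∑' m, k m ^ (2 * ρ))).of_nonneg_of_le
    (fun _ => mul_nonneg (norm_nonneg _) (tsum_rpow_mul_rpow_nonneg hk0 _)) fun l =>
      mul_le_mul_of_nonneg_left (tsum_rpow_mul_rpow_add_le hk0 hk (l + N)) (norm_nonneg _)

theorem hasSum_rpow_mul_ite_rpow (hk0 : ∀ n, 0 ≤ k n) (hρ : 0 < ρ)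
    (hk : Summable fun n => k n ^ (2 * ρ)) (N : ℕ) :
    HasSum (fun n => (k n * if n < N then 0 else k (n - N)) ^ ρ)
      (∑' m, k m ^ ρ * k (m + N) ^ ρ) := by
  have hzero : ∑ n ∈ Finset.range N, (k n * if n < N then 0 else k (n - N)) ^ ρ = 0 :=
    Finset.sum_eq_zero fun n hn => by
      rw [if_pos (Finset.mem_range.1 hn), mul_zero, Real.zero_rpow hρ.ne']
  have hshift : ∀ m, (k (m + N) * if m + N < N then 0 else k (m + N - N)) ^ ρ =
      k m ^ ρ * k (m + N) ^ ρ := fun m => by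
    rw [if_neg (by omega), Nat.add_sub_cancel, Real.mul_rpow (hk0 _) (hk0 _), mul_comm]
  rw [← hasSum_nat_add_iff' N, hzero, sub_zero]
  simpa only [hshift] using (summable_rpow_mul_rpow_add hk0 hk N).hasSum

end Coefficients

/-- The term `k_n u_n e_n` of the series built from a scalar sequence `u`; the random series of the
theorem is obtained from `u_n = θ_{1,n} + i θ_{2,n}`. -/
noncomputable def weightedTerm (p : ℝ≥0∞) (k : ℕ → ℝ) (u : ℕ → ℂ) (n : ℕ) : SeqSpace p :=
  ((k n : ℂ) * u n) • basisVec p n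

/-- The series `∑_n k_n u_n e_n` in `ℓ^p(ℕ)`, as a function of the scalar sequence `u`. It is the
junk value `0` when the series is not summable. -/
noncomputable def weightedSeries (p : ℝ≥0∞) [Fact (1 ≤ p)] (k : ℕ → ℝ) (u : ℕ → ℂ) : SeqSpace p :=
  ∑' n, weightedTerm p k u n

section WeightedSeries

variable {p : ℝ≥0∞} [Fact (1 ≤ p)] {k : ℕ → ℝ} {u : ℕ → ℂ}

theorem norm_basisVec (n : ℕ) : ‖basisVec p n‖ = 1 := by
  rw [basisVec, lp.norm_single (zero_lt_one.trans_le Fact.out), norm_one]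

theorem norm_weightedTerm (hk : ∀ n, 0 ≤ k n) (n : ℕ) :
    ‖weightedTerm p k u n‖ = k n * ‖u n‖ := by
  rw [weightedTerm, norm_smul, norm_basisVec, mul_one, norm_mul, Complex.norm_real,
    Real.norm_of_nonneg (hk n)]

theorem summable_weightedTerm (hp : p ≠ ∞) (hk : ∀ n, 0 ≤ k n)
    (hku : Summable fun n => (k n * ‖u n‖) ^ p.toReal) : Summable (weightedTerm p k u) := by
  have hmem : Memℓp (fun n => (k n : ℂ) * u n) p := memℓp_gen <| by
    simpa only [norm_mul, Complex.norm_real, Real.norm_of_nonneg (hk _)] using hku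
  convert (lp.hasSum_single hp (⟨_, hmem⟩ : SeqSpace p)).summable using 2 with n
  rw [weightedTerm, basisVec, ← lp.single_smul, smul_eq_mul, mul_one]

variable {k₀ : ℝ} {w : ℕ → ℝ} {hw : ∃ C, ∀ n, |w n| ≤ C}

theorem backwardShift_weightedTerm_zero :
    backwardShift p w hw (weightedTerm p k u 0) = 0 := by
  rw [weightedTerm, map_smul, backwardShift_basisVec_zero, smul_zero]

theorem backwardShift_weightedTerm_succ (hw0 : ∀ n, w n ≠ 0) (n : ℕ) :
    backwardShift p w hw (weightedTerm p (coeff k₀ w) u (n + 1)) =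
      weightedTerm p (coeff k₀ w) (fun m => u (m + 1)) n := by
  rw [weightedTerm, map_smul, backwardShift_basisVec_succ, smul_smul, mul_right_comm,
    ← Complex.ofReal_mul, coeff_succ_mul hw0, weightedTerm]

theorem backwardShift_weightedSeries (hw0 : ∀ n, w n ≠ 0)
    (hu : Summable (weightedTerm p (coeff k₀ w) u)) :
    backwardShift p w hw (weightedSeries p (coeff k₀ w) u) =
      weightedSeries p (coeff k₀ w) fun m => u (m + 1) := by
  have hTu : Summable fun n => backwardShift p w hw (weightedTerm p (coeff k₀ w) u n) :=
    (backwardShift p w hw).summable hu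
  rw [weightedSeries, (backwardShift p w hw).map_tsum hu, hTu.tsum_eq_zero_add,
    backwardShift_weightedTerm_zero, zero_add]
  simp only [backwardShift_weightedTerm_succ hw0, weightedSeries]

theorem backwardShift_pow_weightedTerm_of_lt (hw0 : ∀ n, w n ≠ 0) {n N : ℕ} (h : n < N) :
    (backwardShift p w hw ^ N) (weightedTerm p (coeff k₀ w) u n) = 0 := by
  induction N generalizing n u with
  | zero => omega
  | succ N ih =>
    rw [pow_succ, mul_apply_eq_comp]
    cases n with
    | zero => rw [backwardShift_weightedTerm_zero, map_zero]
    | succ n => rw [backwardShift_weightedTerm_succ hw0, ih (by omega)]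

theorem backwardShift_pow_weightedTerm_add (hw0 : ∀ n, w n ≠ 0) (n N : ℕ) :
    (backwardShift p w hw ^ N) (weightedTerm p (coeff k₀ w) u (n + N)) =
      weightedTerm p (coeff k₀ w) (fun m => u (m + N)) n := by
  induction N generalizing u with
  | zero => simp
  | succ N ih =>
    rw [pow_succ, mul_apply_eq_comp, ← add_assoc, backwardShift_weightedTerm_succ hw0, ih]
    rfl

theorem norm_backwardShift_pow_weightedTerm (hk₀ : 0 ≤ k₀) (hw_pos : ∀ n, 0 < w n) (N n : ℕ) :
    ‖(backwardShift p w hw ^ N) (weightedTerm p (coeff k₀ w) u n)‖ =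
      (if n < N then 0 else coeff k₀ w (n - N)) * ‖u n‖ := by
  have hw0 : ∀ n, w n ≠ 0 := fun n => (hw_pos n).ne'
  split_ifs with h
  · rw [backwardShift_pow_weightedTerm_of_lt hw0 h, norm_zero, zero_mul]
  · obtain ⟨m, rfl⟩ := Nat.exists_eq_add_of_le' (not_lt.1 h)
    rw [backwardShift_pow_weightedTerm_add hw0, Nat.add_sub_cancel,
      norm_weightedTerm (coeff_nonneg hk₀ fun n => (hw_pos n).le)]

end WeightedSeries

/-! ### Weighted series of independent random variables -/

section RandomWeightedSeries

variable {Ω : Type*} [MeasurableSpace Ω] {P : Measure Ω} {p : ℝ≥0∞} [Fact (1 ≤ p)] {k : ℕ → ℝ}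
  {ζ : ℕ → Ω → ℂ}

theorem ae_summable_weightedTerm (hp : p ≠ ∞) (hk0 : ∀ n, 0 ≤ k n)
    (hk : Summable fun n => k n ^ p.toReal) (hident : ∀ n, IdentDistrib (ζ n) (ζ 0) P P)
    (hmom : MemLp (ζ 0) p P) : ∀ᵐ ω ∂P, Summable (weightedTerm p k (ζ · ω)) := by
  have hp0 : p ≠ 0 := (zero_lt_one.trans_le Fact.out).ne'
  have hid : ∀ n, IdentDistrib (fun ω => ‖ζ n ω‖ ^ p.toReal) (fun ω => ‖ζ 0 ω‖ ^ p.toReal) P P :=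
    fun n => (hident n).comp (measurable_norm.pow_const p.toReal)
  have hfin : ∑' n, eLpNorm (k n ^ p.toReal • fun ω => ‖ζ n ω‖ ^ p.toReal) 1 P ≠ ∞ := by
    simp only [eLpNorm_const_smul, (hid _).eLpNorm_eq, ENNReal.tsum_mul_right]
    refine ENNReal.mul_ne_top ?_
      (memLp_one_iff_integrable.2 (hmom.integrable_norm_rpow hp0 hp)).eLpNorm_ne_top
    exact tsum_enorm_ne_top_iff_summable_norm.2 hk.norm
  filter_upwards [summable_norm_of_tsum_eLpNorm_ne_top le_rfl
    (fun n => ((hid n).aemeasurable_fst.const_smul _).aestronglyMeasurable) hfin] with ω hω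
  refine summable_weightedTerm hp hk0 (hω.congr fun n => ?_)
  rw [Pi.smul_apply, smul_eq_mul, ← Real.mul_rpow (hk0 n) (norm_nonneg _), Real.norm_of_nonneg]
  exact Real.rpow_nonneg (mul_nonneg (hk0 n) (norm_nonneg _)) _

variable [MeasurableSpace (SeqSpace p)] [BorelSpace (SeqSpace p)]

theorem aemeasurable_weightedSeries (hζ : ∀ n, AEMeasurable (ζ n) P)
    (hs : ∀ᵐ ω ∂P, Summable (weightedTerm p k (ζ · ω))) :
    AEMeasurable (fun ω => weightedSeries p k (ζ · ω)) P := by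
  have hsum : ∀ N, AEStronglyMeasurable
      (fun ω => ∑ n ∈ Finset.range N, weightedTerm p k (ζ · ω) n) P := fun N =>
    Finset.aestronglyMeasurable_fun_sum _ fun n _ =>
      ((hζ n).const_mul (k n : ℂ)).aestronglyMeasurable.smul_const _
  exact (aestronglyMeasurable_of_tendsto_ae atTop hsum
    (hs.mono fun ω hω => hω.hasSum.tendsto_sum_nat)).aemeasurable

theorem aemeasurable_weightedSeries_map (hp : p ≠ ∞) (hk0 : ∀ n, 0 ≤ k n)
    (hk : Summable fun n => k n ^ p.toReal) (hident : ∀ n, IdentDistrib (ζ n) (ζ 0) P P)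
    (hmom : MemLp (ζ 0) p P) : AEMeasurable (weightedSeries p k) (P.map fun ω n => ζ n ω) := by
  have hζ : AEMeasurable (fun ω n => ζ n ω) P :=
    aemeasurable_pi_lambda _ fun n => (hident n).aemeasurable_fst
  have heval : ∀ n, AEMeasurable (fun u : ℕ → ℂ => u n) (P.map fun ω n => ζ n ω) := fun n =>
    (measurable_pi_apply n).aemeasurable
  have hmap : ∀ n, (P.map fun ω n => ζ n ω).map (fun u : ℕ → ℂ => u n) = P.map (ζ n) := fun n =>
    AEMeasurable.map_map_of_aemeasurable (heval n) hζ
  have hmom' : MemLp (fun u : ℕ → ℂ => u 0) p (P.map fun ω n => ζ n ω) :=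
    (memLp_map_measure_iff (heval 0).aestronglyMeasurable hζ).2 hmom
  exact aemeasurable_weightedSeries heval <| ae_summable_weightedTerm hp hk0 hk
    (fun n => ⟨heval n, heval 0, by rw [hmap, hmap, (hident n).map_eq]⟩) hmom'

variable {k₀ : ℝ} {w : ℕ → ℝ} {hw : ∃ C, ∀ n, |w n| ≤ C}

theorem measurePreserving_backwardShift (hp : p ≠ ∞) (hk₀ : 0 ≤ k₀) (hw_pos : ∀ n, 0 < w n)
    (hk : Summable fun n => coeff k₀ w n ^ p.toReal) (hindep : iIndepFun ζ P)
    (hident : ∀ n, IdentDistrib (ζ n) (ζ 0) P P) (hmom : MemLp (ζ 0) p P) :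
    MeasurePreserving (backwardShift p w hw)
      (P.map fun ω => weightedSeries p (coeff k₀ w) (ζ · ω))
      (P.map fun ω => weightedSeries p (coeff k₀ w) (ζ · ω)) := by
  have hk0 := coeff_nonneg hk₀ fun n => (hw_pos n).le
  have hs := ae_summable_weightedTerm hp hk0 hk hident hmom
  have hZ := aemeasurable_weightedSeries (fun n => (hident n).aemeasurable_fst) hs
  have hT : Measurable (backwardShift p w hw) := (backwardShift p w hw).continuous.measurable
  have hshift : IdentDistrib (fun ω n => ζ n ω) (fun ω n => ζ (n + 1) ω) P P :=
    .pi (fun n => (hident n).trans (hident (n + 1)).symm) hindep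
      (hindep.precomp (add_left_injective 1))
  refine ⟨hT, ?_⟩
  rw [AEMeasurable.map_map_of_aemeasurable hT.aemeasurable hZ]
  calc P.map (backwardShift p w hw ∘ fun ω => weightedSeries p (coeff k₀ w) (ζ · ω))
      = P.map fun ω => weightedSeries p (coeff k₀ w) fun n => ζ (n + 1) ω :=
        Measure.map_congr <| hs.mono fun ω hω =>
          backwardShift_weightedSeries (fun n => (hw_pos n).ne') hω
    _ = P.map fun ω => weightedSeries p (coeff k₀ w) (ζ · ω) :=
        (hshift.comp_of_aemeasurable
          (aemeasurable_weightedSeries_map hp hk0 hk hident hmom)).map_eq.symm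

end RandomWeightedSeries

section WeightedSeriesDecorrelation

variable {Ω : Type*} [MeasurableSpace Ω] {P : Measure Ω} [IsProbabilityMeasure P] {p : ℝ≥0∞}
  [Fact (1 ≤ p)] {k₀ : ℝ} {w : ℕ → ℝ} {hw : ∃ C, ∀ n, |w n| ≤ C} {ζ : ℕ → Ω → ℂ}

theorem norm_bilinCov_expI_weightedTerm_le (hp : p ≤ 2) (hk₀ : 0 ≤ k₀) (hw_pos : ∀ n, 0 < w n)
    {n : ℕ} (hmom : MemLp (ζ n) p P) (f g : SeqSpace p →L[ℝ] ℝ) (N : ℕ) :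
    ‖bilinCov P (fun ω => expI (f (weightedTerm p (coeff k₀ w) (ζ · ω) n)))
      (fun ω => expI (g ((backwardShift p w hw ^ N) (weightedTerm p (coeff k₀ w) (ζ · ω) n))))‖ ≤
      8 * (∫ ω, ‖ζ n ω‖ ^ p.toReal ∂P) * (‖f‖ * ‖g‖) ^ (p.toReal / 2) *
        (coeff k₀ w n * if n < N then 0 else coeff k₀ w (n - N)) ^ (p.toReal / 2) := by
  have hp_top : p ≠ ∞ := ne_top_of_le_ne_top ENNReal.ofNat_ne_top hp
  have hk0 : ∀ n, 0 ≤ coeff k₀ w n := coeff_nonneg hk₀ fun n => (hw_pos n).le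
  have hκ0 : 0 ≤ if n < N then 0 else coeff k₀ w (n - N) := by split_ifs <;> simp only [le_rfl, hk0]
  have h2ρ : 2 * (p.toReal / 2) = p.toReal := mul_div_cancel₀ _ two_ne_zero
  have hρ : 0 < p.toReal / 2 :=
    half_pos (ENNReal.toReal_pos (zero_lt_one.trans_le Fact.out).ne' hp_top)
  have hρ1 : p.toReal / 2 ≤ 1 :=
    (div_le_one two_pos).2 (ENNReal.toReal_mono ENNReal.ofNat_ne_top hp)
  have hmeas : ∀ h : SeqSpace p →L[ℝ] ℝ,
      AEMeasurable (fun ω => h (weightedTerm p (coeff k₀ w) (ζ · ω) n)) P := fun h => by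
    have : Continuous fun c : ℂ => h (((coeff k₀ w n : ℂ) * c) • basisVec p n) := by fun_prop
    exact this.measurable.comp_aemeasurable hmom.aestronglyMeasurable.aemeasurable
  have hg : ∀ ω, |g ((backwardShift p w hw ^ N) (weightedTerm p (coeff k₀ w) (ζ · ω) n))| ≤
      (‖g‖ * if n < N then 0 else coeff k₀ w (n - N)) * ‖ζ n ω‖ := fun ω =>
    (g.le_opNorm _).trans_eq (by
      rw [norm_backwardShift_pow_weightedTerm hk₀ hw_pos, mul_assoc])
  have hmain := norm_bilinCov_expI_le (ζ := ζ n) hρ hρ1 (mul_nonneg (norm_nonneg f) (hk0 n))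
    (mul_nonneg (norm_nonneg g) hκ0) (hmeas f)
    (hmeas (g.comp ((backwardShift p w hw ^ N).restrictScalars ℝ)))
    (by rw [h2ρ, ENNReal.ofReal_toReal hp_top]; exact hmom)
    (fun ω => (f.le_opNorm _).trans_eq (by rw [norm_weightedTerm hk0, mul_assoc]))
    hg
  rw [h2ρ, mul_mul_mul_comm, Real.mul_rpow (by positivity) (mul_nonneg (hk0 n) hκ0),
    ← mul_assoc] at hmain
  exact hmain

theorem norm_bilinCov_expI_weightedSeries_le (hp : p ≤ 2) (hk₀ : 0 ≤ k₀) (hw_pos : ∀ n, 0 < w n)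
    (hk : Summable fun n => coeff k₀ w n ^ p.toReal) (hindep : iIndepFun ζ P)
    (hident : ∀ n, IdentDistrib (ζ n) (ζ 0) P P) (hmom : MemLp (ζ 0) p P)
    (f g : SeqSpace p →L[ℝ] ℝ) (N : ℕ) :
    ‖bilinCov P (fun ω => expI (f (weightedSeries p (coeff k₀ w) (ζ · ω))))
      (fun ω => expI (g ((backwardShift p w hw ^ N) (weightedSeries p (coeff k₀ w) (ζ · ω)))))‖ ≤
      8 * (∫ ω, ‖ζ 0 ω‖ ^ p.toReal ∂P) * (‖f‖ * ‖g‖) ^ (p.toReal / 2) *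
        ∑' m, coeff k₀ w m ^ (p.toReal / 2) * coeff k₀ w (m + N) ^ (p.toReal / 2) := by
  have hp_top : p ≠ ∞ := ne_top_of_le_ne_top ENNReal.ofNat_ne_top hp
  have hk0 : ∀ n, 0 ≤ coeff k₀ w n := coeff_nonneg hk₀ fun n => (hw_pos n).le
  have hρ : 0 < p.toReal / 2 :=
    half_pos (ENNReal.toReal_pos (zero_lt_one.trans_le Fact.out).ne' hp_top)
  have hs := ae_summable_weightedTerm hp_top hk0 hk hident hmom
  let X (h : SeqSpace p →L[ℝ] ℝ) (n : ℕ) (c : ℂ) : ℝ := h (((coeff k₀ w n : ℂ) * c) • basisVec p n)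
  have hX : ∀ h n, Measurable (X h n) := fun h n =>
    Continuous.measurable (by simp only [X]; fun_prop)
  have hζ : ∀ n, AEMeasurable (ζ n) P := fun n => (hident n).aemeasurable_fst
  let g' := g.comp ((backwardShift p w hw ^ N).restrictScalars ℝ)
  refine norm_bilinCov_expI_le_of_hasSum (X := fun n ω => X f n (ζ n ω))
    (Y := fun n ω => X g' n (ζ n ω)) (fun n => (hX f n).comp_aemeasurable (hζ n))
    (fun n => (hX g' n).comp_aemeasurable (hζ n))
    (hindep.comp (fun n c => (X f n c, X g' n c)) fun n => (hX f n).prodMk (hX g' n))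
    (hs.mono fun ω hω => f.hasSum hω.hasSum) (hs.mono fun ω hω => g'.hasSum hω.hasSum) (fun n => ?_)
    ((hasSum_rpow_mul_ite_rpow hk0 hρ (by rwa [mul_div_cancel₀ _ two_ne_zero]) N).mul_left _)
  have hpow : ∫ ω, ‖ζ n ω‖ ^ p.toReal ∂P = ∫ ω, ‖ζ 0 ω‖ ^ p.toReal ∂P :=
    ((hident n).comp (measurable_norm.pow_const p.toReal)).integral_eq
  rw [← hpow]
  exact norm_bilinCov_expI_weightedTerm_le hp hk₀ hw_pos ((hident n).memLp_iff.2 hmom) f g N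

end WeightedSeriesDecorrelation

/-! ### Exponential series -/

section ExpSeries

variable {E : Type*} [NormedAddCommGroup E] [NormedSpace ℂ E] {T : E →L[ℂ] E} {φ ψ : ℂ → ℝ}
  {a b : ℕ → ℂ} {xs ys : StrongDual ℂ E}

set_option synthInstance.maxHeartbeats 200000 in
-- finding the monoid of endomorphisms of a dual space is slow
theorem dualOp_pow_apply (T : E →L[ℂ] E) (xs : StrongDual ℂ E) (n : ℕ) (z : E) :
    ((dualOp T ^ n) xs) z = xs ((T ^ n) z) := by
  induction n generalizing xs with
  | zero => rfl
  | succ n ih =>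
    rw [pow_succ, mul_apply_eq_comp, ih, pow_succ', mul_apply_eq_comp]
    rfl

theorem norm_dualOp_pow_le (T : E →L[ℂ] E) (xs : StrongDual ℂ E) (n : ℕ) :
    ‖(dualOp T ^ n) xs‖ ≤ ‖xs‖ * ‖T‖ ^ n := by
  refine ContinuousLinearMap.opNorm_le_bound _ (by positivity) fun z => ?_
  rw [dualOp_pow_apply, mul_assoc]
  refine xs.le_opNorm_of_le ?_
  rcases n.eq_zero_or_pos with rfl | hn
  · simp
  · exact (T ^ n).le_of_opNorm_le (norm_pow_le' T hn) z

theorem expTerm_eq (z : E) (j : ℕ) :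
    expTerm T φ a xs z j = a j * expI (φ (((dualOp T ^ j) xs) z)) := rfl

theorem norm_expTerm (z : E) (j : ℕ) : ‖expTerm T φ a xs z j‖ = ‖a j‖ := by
  rw [expTerm_eq, norm_mul, norm_expI, mul_one]

theorem expSeries_pow_apply (n : ℕ) (z : E) :
    expSeries T φ a xs ((T ^ n) z) = expSeries T φ a ((dualOp T ^ n) xs) z := by
  have hcomm : ∀ j, (T ^ j) ((T ^ n) z) = (T ^ n) ((T ^ j) z) := fun j => by
    rw [← mul_apply_eq_comp, ← mul_apply_eq_comp, pow_mul_comm]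
  simp only [expSeries, expTerm_eq, dualOp_pow_apply, hcomm]

theorem continuous_expTerm (hφ : Continuous φ) (j : ℕ) :
    Continuous fun z => expTerm T φ a xs z j :=
  continuous_const.mul (continuous_expI.comp (hφ.comp ((dualOp T ^ j) xs).continuous))

theorem continuous_expSeries (hφ : Continuous φ) (ha : Summable fun j => ‖a j‖) :
    Continuous (expSeries T φ a xs) :=
  continuous_tsum (continuous_expTerm hφ) ha fun j z => (norm_expTerm z j).le

theorem norm_expSeries_le (ha : Summable fun j => ‖a j‖) (z : E) :
    ‖expSeries T φ a xs z‖ ≤ ∑' j, ‖a j‖ :=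
  tsum_of_norm_bounded ha.hasSum fun j => (norm_expTerm z j).le

variable [MeasurableSpace E]

theorem correlation_eq_bilinCov {μ : Measure E} (hT : MeasurePreserving T μ μ) (n : ℕ)
    (f : E → ℂ) {g : E → ℂ} (hg : AEStronglyMeasurable g μ) :
    correlation T μ n f g = bilinCov μ f fun z => g ((T ^ n) z) := by
  have hTn : MeasurePreserving (fun z => (T ^ n) z) μ μ := by
    rw [FunLike.coe_pow_eq_iterate]
    exact hT.iterate n
  have hint : ∫ z, g ((T ^ n) z) ∂μ = ∫ z, g z ∂μ := by
    rw [← integral_map hTn.aemeasurable (by rwa [hTn.map_eq]), hTn.map_eq]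
  rw [correlation, bilinCov, hint]

variable [BorelSpace E] {μ : Measure E} [IsFiniteMeasure μ]

theorem memLp_expSeries (hφ : Continuous φ) (ha : Summable fun j => ‖a j‖) (r : ℝ≥0∞) :
    MemLp (expSeries T φ a xs) r μ :=
  MemLp.of_bound (continuous_expSeries hφ ha).measurable.aestronglyMeasurable _
    (ae_of_all _ (norm_expSeries_le ha))

theorem norm_bilinCov_expSeries_left_le {G : E → ℂ} {C : ℝ} {s : ℕ → ℝ} (hφ : Continuous φ)
    (ha : Summable fun j => ‖a j‖) (hG : Continuous G) (hGC : ∀ z, ‖G z‖ ≤ C)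
    (hs : Summable fun j => ‖a j‖ * s j)
    (h : ∀ j, ‖bilinCov μ (fun z => expI (φ (((dualOp T ^ j) xs) z))) G‖ ≤ s j) :
    ‖bilinCov μ (expSeries T φ a xs) G‖ ≤ ∑' j, ‖a j‖ * s j := by
  refine (hasSum_bilinCov (F := fun j z => expTerm T φ a xs z j)
    (fun j => (continuous_expTerm hφ j).measurable.aestronglyMeasurable)
    hG.measurable.aestronglyMeasurable (fun j z => (norm_expTerm z j).le) hGC
    ha).norm_le_of_bounded hs.hasSum fun j => ?_
  simp only [expTerm_eq, bilinCov_const_mul, norm_mul]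
  gcongr
  exact h j

theorem norm_bilinCov_expSeries_le {r s : ℕ → ℝ} (hφ : Continuous φ) (hψ : Continuous ψ)
    (ha : Summable fun j => ‖a j‖) (hb : Summable fun l => ‖b l‖)
    (hr : Summable fun j => ‖a j‖ * r j) (hs : Summable fun l => ‖b l‖ * s l)
    (h : ∀ j l, ‖bilinCov μ (fun z => expI (φ (((dualOp T ^ j) xs) z)))
      (fun z => expI (ψ (((dualOp T ^ l) ys) z)))‖ ≤ r j * s l) :
    ‖bilinCov μ (expSeries T φ a xs) (expSeries T ψ b ys)‖ ≤
      (∑' j, ‖a j‖ * r j) * ∑' l, ‖b l‖ * s l := by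
  have hterm : ∀ j, ‖bilinCov μ (fun z => expI (φ (((dualOp T ^ j) xs) z)))
      (expSeries T ψ b ys)‖ ≤ r j * ∑' l, ‖b l‖ * s l := fun j => by
    simp only [bilinCov_comm (fun _ => expI (φ _)), ← tsum_mul_left, mul_left_comm (r j)] at h ⊢
    exact norm_bilinCov_expSeries_left_le hψ hb
      (continuous_expI.comp (hφ.comp ((dualOp T ^ j) xs).continuous)) (fun _ => (norm_expI _).le)
      (by simpa only [mul_left_comm] using hs.mul_left (r j)) (h j)
  simp only [← tsum_mul_right, mul_assoc]
  exact norm_bilinCov_expSeries_left_le hφ ha (continuous_expSeries hψ hb) (norm_expSeries_le hb)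
    (by simpa only [mul_assoc] using hr.mul_right _) hterm

end ExpSeries

section GeneralTheorem

variable {Ω : Type*} [MeasurableSpace Ω] {P : Measure Ω} [IsProbabilityMeasure P] {p : ℝ≥0∞}
  [Fact (1 ≤ p)] {k₀ : ℝ} {w : ℕ → ℝ} {hw : ∃ C, ∀ n, |w n| ≤ C} {ζ : ℕ → Ω → ℂ}
  [MeasurableSpace (SeqSpace p)] [BorelSpace (SeqSpace p)]

theorem norm_bilinCov_expI_dualOp_pow_le (hp : p ≤ 2) (hk₀ : 0 ≤ k₀) (hw_pos : ∀ n, 0 < w n)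
    (hk : Summable fun n => coeff k₀ w n ^ p.toReal) (hindep : iIndepFun ζ P)
    (hident : ∀ n, IdentDistrib (ζ n) (ζ 0) P P) (hmom : MemLp (ζ 0) p P) (L L' : ℂ →L[ℝ] ℝ)
    (xs ys : StrongDual ℂ (SeqSpace p)) (j N : ℕ) :
    ‖bilinCov (P.map fun ω => weightedSeries p (coeff k₀ w) (ζ · ω))
      (fun z => expI (L (((dualOp (backwardShift p w hw) ^ j) xs) z)))
      (fun z => expI (L' (((dualOp (backwardShift p w hw) ^ N) ys) z)))‖ ≤
      8 * (∫ ω, ‖ζ 0 ω‖ ^ p.toReal ∂P) * (‖L‖ * ‖xs‖ * (‖L'‖ * ‖ys‖)) ^ (p.toReal / 2) *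
        ‖backwardShift p w hw‖ ^ (j * p.toReal / 2) *
        ∑' m, coeff k₀ w m ^ (p.toReal / 2) * coeff k₀ w (m + N) ^ (p.toReal / 2) := by
  have hp_top : p ≠ ∞ := ne_top_of_le_ne_top ENNReal.ofNat_ne_top hp
  have hk0 : ∀ n, 0 ≤ coeff k₀ w n := coeff_nonneg hk₀ fun n => (hw_pos n).le
  have hZ := aemeasurable_weightedSeries (fun n => (hident n).aemeasurable_fst)
    (ae_summable_weightedTerm hp_top hk0 hk hident hmom)
  have hmeas : ∀ (M : ℂ →L[ℝ] ℝ) (x : StrongDual ℂ (SeqSpace p)),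
      Measurable fun z => expI (M (x z)) := fun M x =>
    (continuous_expI.comp (M.continuous.comp x.continuous)).measurable
  let x := (dualOp (backwardShift p w hw) ^ j) xs
  let f : SeqSpace p →L[ℝ] ℝ := L.comp (x.restrictScalars ℝ)
  let g : SeqSpace p →L[ℝ] ℝ := L'.comp (ys.restrictScalars ℝ)
  have hf : ‖f‖ ≤ ‖L‖ * (‖xs‖ * ‖backwardShift p w hw‖ ^ j) :=
    (L.opNorm_comp_le _).trans (by gcongr; exact norm_dualOp_pow_le _ xs j)
  have hg : ‖g‖ ≤ ‖L'‖ * ‖ys‖ := L'.opNorm_comp_le _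
  have hfg : (‖f‖ * ‖g‖) ^ (p.toReal / 2) ≤ (‖L‖ * ‖xs‖ * (‖L'‖ * ‖ys‖)) ^ (p.toReal / 2) *
      ‖backwardShift p w hw‖ ^ (j * p.toReal / 2) := by
    rw [mul_div_assoc, Real.rpow_natCast_mul (norm_nonneg _),
      ← Real.mul_rpow (by positivity) (by positivity)]
    refine Real.rpow_le_rpow (by positivity) ?_ (by positivity)
    calc ‖f‖ * ‖g‖ ≤ ‖L‖ * (‖xs‖ * ‖backwardShift p w hw‖ ^ j) * (‖L'‖ * ‖ys‖) := by gcongr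
      _ = ‖L‖ * ‖xs‖ * (‖L'‖ * ‖ys‖) * ‖backwardShift p w hw‖ ^ j := by ring
  rw [bilinCov_map hZ (hmeas L _) (hmeas L' _)]
  simp only [dualOp_pow_apply _ ys]
  refine (norm_bilinCov_expI_weightedSeries_le hp hk₀ hw_pos hk hindep hident hmom f g N).trans ?_
  rw [mul_assoc _ (_ ^ _) (_ ^ _)]
  gcongr
  exact tsum_rpow_mul_rpow_nonneg hk0 _

theorem norm_correlation_expSeries_le (hp : p ≤ 2) (hk₀ : 0 ≤ k₀) (hw_pos : ∀ n, 0 < w n)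
    (hk : Summable fun n => coeff k₀ w n ^ p.toReal) (hindep : iIndepFun ζ P)
    (hident : ∀ n, IdentDistrib (ζ n) (ζ 0) P P) (hmom : MemLp (ζ 0) p P)
    {μ : Measure (SeqSpace p)} (hμ : μ = P.map fun ω => weightedSeries p (coeff k₀ w) (ζ · ω))
    {T : SeqSpace p →L[ℂ] SeqSpace p} (hT : T = backwardShift p w hw) {a b : ℕ → ℂ}
    (ha : Summable fun j => ‖a j‖) (hb : Summable fun l => ‖b l‖)
    (haT : Summable fun j : ℕ => ‖a j‖ * ‖T‖ ^ (j * p.toReal / 2)) (L L' : ℂ →L[ℝ] ℝ)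
    (xs ys : StrongDual ℂ (SeqSpace p)) (n : ℕ) :
    ‖correlation T μ n (expSeries T L a xs) (expSeries T L' b ys)‖ ≤
      8 * (∫ ω, ‖ζ 0 ω‖ ^ p.toReal ∂P) * (‖L‖ * ‖xs‖ * (‖L'‖ * ‖ys‖)) ^ (p.toReal / 2) *
        (∑' j : ℕ, ‖a j‖ * ‖T‖ ^ (j * p.toReal / 2)) *
        ∑' l, ‖b l‖ *
          ∑' j, coeff k₀ w j ^ (p.toReal / 2) * coeff k₀ w (j + l + n) ^ (p.toReal / 2) := by
  have hp_top : p ≠ ∞ := ne_top_of_le_ne_top ENNReal.ofNat_ne_top hp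
  have hk0 : ∀ n, 0 ≤ coeff k₀ w n := coeff_nonneg hk₀ fun n => (hw_pos n).le
  have : IsProbabilityMeasure μ := hμ ▸ Measure.isProbabilityMeasure_map
    (aemeasurable_weightedSeries (fun n => (hident n).aemeasurable_fst)
      (ae_summable_weightedTerm hp_top hk0 hk hident hmom))
  have hinv : MeasurePreserving T μ μ := by
    subst hμ hT
    exact measurePreserving_backwardShift hp_top hk₀ hw_pos hk hindep hident hmom
  have hk' : Summable fun n => coeff k₀ w n ^ (2 * (p.toReal / 2)) := by
    rwa [mul_div_cancel₀ _ two_ne_zero]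
  rw [correlation_eq_bilinCov hinv n _
    (continuous_expSeries L'.continuous hb).measurable.aestronglyMeasurable]
  simp only [expSeries_pow_apply, add_assoc, ← tsum_mul_left (a := _ * _ ^ _),
    mul_left_comm _ ‖a _‖]
  refine norm_bilinCov_expSeries_le (r := fun j => _) (s := fun l => _) L.continuous L'.continuous
    ha hb ((haT.mul_left _).congr fun j => mul_left_comm _ _ _)
    (summable_norm_mul_tsum_rpow_mul_rpow_add hb hk0 hk' n) fun j l => ?_
  have hdual : ∀ z, ((dualOp T ^ l) ((dualOp T ^ n) ys)) z = ((dualOp T ^ (l + n)) ys) z :=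
    fun z => by rw [dualOp_pow_apply, dualOp_pow_apply, dualOp_pow_apply, ← mul_apply_eq_comp,
      ← pow_add, add_comm]
  simp only [hdual]
  subst hμ hT
  exact norm_bilinCov_expI_dualOp_pow_le hp hk₀ hw_pos hk hindep hident hmom L L' xs ys j (l + n)

theorem corollary6p6_general (hp : p ≤ 2) (hk₀ : 0 ≤ k₀) (hw_pos : ∀ n, 0 < w n)
    (hk : Summable fun n => coeff k₀ w n ^ p.toReal) (hindep : iIndepFun ζ P)
    (hident : ∀ n, IdentDistrib (ζ n) (ζ 0) P P) (hmom : MemLp (ζ 0) p P)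
    {μ : Measure (SeqSpace p)} (hμ : μ = P.map fun ω => weightedSeries p (coeff k₀ w) (ζ · ω))
    {T : SeqSpace p →L[ℂ] SeqSpace p} (hT : T = backwardShift p w hw) {a b : ℕ → ℂ}
    (ha : Summable fun j => ‖a j‖) (hb : Summable fun l => ‖b l‖)
    (haT : Summable fun j : ℕ => ‖a j‖ * ‖T‖ ^ ((j : ℝ) * p.toReal / 2)) (L L' : ℂ →L[ℝ] ℝ)
    (xs ys : StrongDual ℂ (SeqSpace p)) :
    ((∀ᵐ ω ∂P, Summable (weightedTerm p (coeff k₀ w) (ζ · ω))) ∧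
      AEMeasurable (fun ω => weightedSeries p (coeff k₀ w) (ζ · ω)) P) ∧
    (∀ z, Summable fun j => ‖expTerm T L a xs z j‖) ∧
    (∀ z, Summable fun l => ‖expTerm T L' b ys z l‖) ∧
    MemLp (expSeries T L a xs) 2 μ ∧
    MemLp (expSeries T L' b ys) 2 μ ∧
    ∃ C : ℝ, 0 < C ∧ ∀ n : ℕ,
      ‖correlation T μ n (expSeries T L a xs) (expSeries T L' b ys)‖ ≤
        C * ∑' l : ℕ, ‖b l‖ *
          ∑' j : ℕ, coeff k₀ w j ^ (p.toReal / 2) * coeff k₀ w (j + l + n) ^ (p.toReal / 2) := by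
  have hp_top : p ≠ ∞ := ne_top_of_le_ne_top ENNReal.ofNat_ne_top hp
  have hk0 : ∀ n, 0 ≤ coeff k₀ w n := coeff_nonneg hk₀ fun n => (hw_pos n).le
  have hs := ae_summable_weightedTerm hp_top hk0 hk hident hmom
  have hZ := aemeasurable_weightedSeries (fun n => (hident n).aemeasurable_fst) hs
  have : IsProbabilityMeasure μ := hμ ▸ Measure.isProbabilityMeasure_map hZ
  refine ⟨⟨hs, hZ⟩, fun z => by simpa only [norm_expTerm] using ha,
    fun z => by simpa only [norm_expTerm] using hb, memLp_expSeries L.continuous ha 2,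
    memLp_expSeries L'.continuous hb 2, ?_⟩
  set D := 8 * (∫ ω, ‖ζ 0 ω‖ ^ p.toReal ∂P) * (‖L‖ * ‖xs‖ * (‖L'‖ * ‖ys‖)) ^ (p.toReal / 2) *
    ∑' j : ℕ, ‖a j‖ * ‖T‖ ^ (j * p.toReal / 2)
  have hD : 0 ≤ D := by positivity
  refine ⟨D + 1, hD.trans_lt (lt_add_one D), fun n => ?_⟩
  refine (norm_correlation_expSeries_le hp hk₀ hw_pos hk hindep hident hmom hμ hT ha hb haT L L'
    xs ys n).trans (mul_le_mul_of_nonneg_right (le_add_of_nonneg_right zero_le_one) ?_)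
  exact tsum_nonneg fun l => mul_nonneg (norm_nonneg _) (tsum_rpow_mul_rpow_nonneg hk0 _)

end GeneralTheorem

/-! ### Second moments of tempered stable laws -/

section TemperedStable

theorem re_charFun {ν : Measure ℝ} [IsFiniteMeasure ν] (t : ℝ) :
    (charFun ν t).re = ∫ x, Real.cos (t * x) ∂ν := by
  have hint : Integrable (fun x : ℝ => Complex.exp (t * x * Complex.I)) ν := by
    refine (integrable_const (1 : ℝ)).mono' (by fun_prop) (Eventually.of_forall fun x => ?_)
    rw [← Complex.ofReal_mul, Complex.norm_exp_ofReal_mul_I]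
  rw [charFun_apply_real, ← RCLike.re_eq_complex_re, ← integral_re hint]
  refine integral_congr_ae (Eventually.of_forall fun x => ?_)
  simp only [RCLike.re_eq_complex_re, ← Complex.ofReal_mul, Complex.exp_ofReal_mul_I_re]

theorem integrable_one_sub_cos {ν : Measure ℝ} [IsFiniteMeasure ν] (t : ℝ) :
    Integrable (fun x => 1 - Real.cos (t * x)) ν :=
  (integrable_const (2 : ℝ)).mono' (by fun_prop) (Eventually.of_forall fun x => by
    rw [Real.norm_eq_abs, abs_le]
    constructor <;> linarith [Real.neg_one_le_cos (t * x), Real.cos_le_one (t * x)])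

theorem integral_one_sub_cos {ν : Measure ℝ} [IsProbabilityMeasure ν] (t : ℝ) :
    ∫ x, (1 - Real.cos (t * x)) ∂ν = 1 - (charFun ν t).re := by
  have hcos : Integrable (fun x => Real.cos (t * x)) ν :=
    (integrable_const (1 : ℝ)).mono' (by fun_prop)
      (Eventually.of_forall fun x => Real.abs_cos_le_one _)
  rw [integral_sub (integrable_const _) hcos, re_charFun]
  simp

theorem sq_le_mul_one_sub_cos {R x : ℝ} (hR : 0 < R) (hx : |x| ≤ R) :
    x ^ 2 ≤ Real.pi ^ 2 / 2 * R ^ 2 * (1 - Real.cos (R⁻¹ * x)) := by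
  have hx' : |R⁻¹ * x| ≤ Real.pi := by
    rw [abs_mul, abs_of_pos (inv_pos.2 hR), inv_mul_le_iff₀ hR]
    nlinarith [Real.pi_gt_three]
  calc x ^ 2 = Real.pi ^ 2 / 2 * R ^ 2 * (2 / Real.pi ^ 2 * (R⁻¹ * x) ^ 2) := by field_simp
    _ ≤ Real.pi ^ 2 / 2 * R ^ 2 * (1 - Real.cos (R⁻¹ * x)) := mul_le_mul_of_nonneg_left
        (by linarith [Real.cos_le_one_sub_mul_cos_sq hx']) (by positivity)

theorem memLp_two_of_one_sub_re_charFun_le {ν : Measure ℝ} [IsProbabilityMeasure ν] {C : ℝ}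
    (h : ∀ t, 1 - (charFun ν t).re ≤ C * t ^ 2) : MemLp id 2 ν := by
  have hint : ∀ R : ℝ, IntegrableOn (fun x => x ^ 2) (Metric.closedBall 0 R) ν := fun R =>
    (continuous_pow 2).continuousOn.integrableOn_compact (isCompact_closedBall 0 R)
  refine (memLp_two_iff_integrable_sq aestronglyMeasurable_id).2
    ((aecover_closedBall tendsto_id).integrable_of_integral_norm_bounded (Real.pi ^ 2 / 2 * C)
      hint ?_)
  filter_upwards [eventually_gt_atTop 0] with R hR
  have hcos : Integrable (fun x => Real.pi ^ 2 / 2 * R ^ 2 * (1 - Real.cos (R⁻¹ * x))) ν :=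
    (integrable_one_sub_cos _).const_mul _
  calc ∫ x in Metric.closedBall 0 R, ‖id x ^ 2‖ ∂ν
      ≤ ∫ x in Metric.closedBall 0 R, Real.pi ^ 2 / 2 * R ^ 2 * (1 - Real.cos (R⁻¹ * x)) ∂ν :=
        setIntegral_mono_on (hint R).norm hcos.integrableOn
          Metric.isClosed_closedBall.measurableSet fun x hx => by
            rw [id, Real.norm_of_nonneg (sq_nonneg x)]
            exact sq_le_mul_one_sub_cos hR (mem_closedBall_zero_iff.1 hx)
    _ ≤ ∫ x, Real.pi ^ 2 / 2 * R ^ 2 * (1 - Real.cos (R⁻¹ * x)) ∂ν :=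
        setIntegral_le_integral hcos (Eventually.of_forall fun x =>
          mul_nonneg (by positivity) (sub_nonneg.2 (Real.cos_le_one _)))
    _ = Real.pi ^ 2 / 2 * R ^ 2 * (1 - (charFun ν R⁻¹).re) := by
        rw [integral_const_mul, integral_one_sub_cos]
    _ ≤ Real.pi ^ 2 / 2 * R ^ 2 * (C * R⁻¹ ^ 2) :=
        mul_le_mul_of_nonneg_left (h _) (by positivity)
    _ = Real.pi ^ 2 / 2 * C := by field_simp

theorem one_sub_re_exp_le {u : ℂ} (hu : u.re ≤ 0) :
    1 - (Complex.exp u).re ≤ -u.re + u.im ^ 2 / 2 := by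
  rw [Complex.exp_re]
  nlinarith [Real.add_one_le_exp u.re, Real.exp_le_one_iff.2 hu, Real.exp_pos u.re,
    Real.one_sub_sq_div_two_le_cos (x := u.im), sq_nonneg u.im]

/-- The integrand `e^{itx} - 1 - i κ(x) t x` of the Lévy–Khintchine formula. -/
noncomputable def levyIntegrand (t x : ℝ) : ℂ :=
  Complex.exp (Complex.I * t * x) - 1 - Complex.I * truncKappa x * t * x

/-- The Lévy exponent `∫ (e^{itx} - 1 - i κ(x) t x) m(dx)` of the centered infinitely divisible law
without Gaussian part and with Lévy measure `m`. -/
noncomputable def levyExponent (m : Measure ℝ) (t : ℝ) : ℂ :=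
  ∫ x, levyIntegrand t x ∂m

theorem abs_truncKappa_le_one (x : ℝ) : |truncKappa x| ≤ 1 := by
  unfold truncKappa
  split_ifs with h
  · exact abs_one.le
  · rw [abs_of_nonneg (by positivity)]
    exact div_le_one_of_le₀ (not_lt.1 h) (abs_nonneg x)

theorem measurable_levyIntegrand (t : ℝ) : Measurable (levyIntegrand t) := by
  have hκ : Measurable truncKappa :=
    Measurable.ite (measurableSet_lt (by fun_prop) (by fun_prop)) (by fun_prop) (by fun_prop)
  unfold levyIntegrand
  fun_prop

theorem re_levyIntegrand (t x : ℝ) : (levyIntegrand t x).re = Real.cos (t * x) - 1 := by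
  simp [levyIntegrand, Complex.exp_re]

theorem norm_levyIntegrand_le (t x : ℝ) : ‖levyIntegrand t x‖ ≤ 2 * |t| * |x| := by
  have hexp : ‖Complex.exp (Complex.I * t * x) - 1‖ ≤ |t| * |x| := by
    rw [mul_assoc, ← Complex.ofReal_mul, ← abs_mul]
    exact Real.norm_exp_I_mul_ofReal_sub_one_le
  have hlin : ‖Complex.I * truncKappa x * t * x‖ ≤ |t| * |x| := by
    simp only [norm_mul, Complex.norm_I, Complex.norm_real, Real.norm_eq_abs, one_mul, mul_assoc]
    exact mul_le_of_le_one_left (by positivity) (abs_truncKappa_le_one x)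
  calc ‖levyIntegrand t x‖ ≤ |t| * |x| + |t| * |x| := (norm_sub_le _ _).trans (add_le_add hexp hlin)
    _ = 2 * |t| * |x| := by ring

variable {m : Measure ℝ}

theorem abs_im_levyExponent_le (hm : Integrable (fun x => |x|) m) (t : ℝ) :
    |(levyExponent m t).im| ≤ 2 * |t| * ∫ x, |x| ∂m := by
  rw [← integral_const_mul]
  exact (Complex.abs_im_le_norm _).trans (norm_integral_le_of_norm_le (hm.const_mul _)
    (Eventually.of_forall (norm_levyIntegrand_le t)))

theorem re_levyExponent (hm : Integrable (fun x => |x|) m) (t : ℝ) :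
    (levyExponent m t).re = ∫ x, (Real.cos (t * x) - 1) ∂m := by
  have hint : Integrable (levyIntegrand t) m :=
    (hm.const_mul _).mono' (measurable_levyIntegrand t).aestronglyMeasurable
      (Eventually.of_forall (norm_levyIntegrand_le t))
  simp only [← re_levyIntegrand]
  exact (integral_re hint).symm

theorem re_levyExponent_nonpos (hm : Integrable (fun x => |x|) m) (t : ℝ) :
    (levyExponent m t).re ≤ 0 := by
  rw [re_levyExponent hm]
  exact integral_nonpos fun x => sub_nonpos.2 (Real.cos_le_one _)

theorem neg_re_levyExponent_le (hm : Integrable (fun x => |x|) m)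
    (hm2 : Integrable (fun x => x ^ 2) m) (t : ℝ) :
    -(levyExponent m t).re ≤ t ^ 2 * ∫ x, x ^ 2 ∂m := by
  rw [re_levyExponent hm, ← integral_neg, ← integral_const_mul]
  refine integral_mono_of_nonneg (Eventually.of_forall fun x => ?_) (hm2.const_mul _)
    (Eventually.of_forall fun x => ?_)
  · simpa using Real.cos_le_one (t * x)
  · change -(Real.cos (t * x) - 1) ≤ t ^ 2 * x ^ 2
    nlinarith [Real.one_sub_sq_div_two_le_cos (x := t * x), sq_nonneg (t * x)]

theorem memLp_two_of_charFun_eq_exp_levyExponent {ν : Measure ℝ} [IsProbabilityMeasure ν]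
    (hν : ∀ t, charFun ν t = Complex.exp (levyExponent m t)) (hm : Integrable (fun x => |x|) m)
    (hm2 : Integrable (fun x => x ^ 2) m) : MemLp id 2 ν := by
  refine memLp_two_of_one_sub_re_charFun_le
    (C := ∫ x, x ^ 2 ∂m + 2 * (∫ x, |x| ∂m) ^ 2) fun t => ?_
  have him : (levyExponent m t).im ^ 2 ≤ (2 * |t| * ∫ x, |x| ∂m) ^ 2 :=
    sq_le_sq.2 ((abs_im_levyExponent_le hm t).trans (le_abs_self _))
  rw [mul_pow, mul_pow, sq_abs] at him
  rw [hν]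
  linarith [one_sub_re_exp_le (re_levyExponent_nonpos hm t), neg_re_levyExponent_le hm hm2 t]

theorem measurable_levyDensity (α aNeg aPos lNeg lPos : ℝ) :
    Measurable (levyDensity α aNeg aPos lNeg lPos) :=
  Measurable.ite measurableSet_Iio (by fun_prop)
    (Measurable.ite measurableSet_Ioi (by fun_prop) measurable_const)

variable {α aNeg aPos lNeg lPos : ℝ}

theorem levyDensity_nonneg (haNeg : 0 ≤ aNeg) (haPos : 0 ≤ aPos) (x : ℝ) :
    0 ≤ levyDensity α aNeg aPos lNeg lPos x := by
  unfold levyDensity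
  split_ifs <;> positivity

theorem integrableOn_rpow_mul_exp_div_rpow {s l : ℝ} (hs : α < s) (a : ℝ) (hl : 0 < l) :
    IntegrableOn (fun x : ℝ => x ^ s * (a * Real.exp (-l * x) / x ^ (1 + α))) (Set.Ioi 0) := by
  have hgamma : IntegrableOn (fun x : ℝ => x ^ (s - 1 - α) * Real.exp (-l * x)) (Set.Ioi 0) := by
    simpa using integrableOn_rpow_mul_exp_neg_mul_rpow (p := 1) (s := s - 1 - α)
      (by linarith) one_pos hl
  refine IntegrableOn.congr_fun (hgamma.const_mul a) (fun x hx => ?_) measurableSet_Ioi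
  simp only [show s - 1 - α = s - (1 + α) by ring, Real.rpow_sub (Set.mem_Ioi.1 hx)]
  ring

theorem integrable_abs_rpow_levyMeasure {s : ℝ} (hs : α < s) (haNeg : 0 ≤ aNeg)
    (haPos : 0 ≤ aPos) (hlNeg : 0 < lNeg) (hlPos : 0 < lPos) :
    Integrable (fun x => |x| ^ s) (levyMeasure α aNeg aPos lNeg lPos) := by
  unfold levyMeasure
  rw [integrable_withDensity_iff (measurable_levyDensity ..).ennreal_ofReal
    (Eventually.of_forall fun x => ENNReal.ofReal_lt_top)]
  simp only [ENNReal.toReal_ofReal (levyDensity_nonneg haNeg haPos _)]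
  rw [← integrableOn_univ, ← Set.Iio_union_Ici (a := (0 : ℝ)), integrableOn_union,
    integrableOn_Ici_iff_integrableOn_Ioi]
  constructor
  · rw [← (Measure.measurePreserving_neg (volume : Measure ℝ)).integrableOn_comp_preimage
      (Homeomorph.neg ℝ).measurableEmbedding]
    simp only [Function.comp_def, Set.neg_preimage, Set.neg_Iio, neg_zero]
    refine (integrableOn_rpow_mul_exp_div_rpow hs aNeg hlNeg).congr_fun (fun x (hx : 0 < x) => ?_)
      measurableSet_Ioi
    simp only [levyDensity, neg_lt_zero, hx, if_true, abs_neg, abs_of_pos hx]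
  · refine (integrableOn_rpow_mul_exp_div_rpow hs aPos hlPos).congr_fun (fun x (hx : 0 < x) => ?_)
      measurableSet_Ioi
    simp only [levyDensity, hx, if_true, abs_of_pos hx, not_lt.2 hx.le, if_false]

theorem IsTemperedStable.memLp_two {ν : Measure ℝ} [IsProbabilityMeasure ν]
    (hν : IsTemperedStable α aNeg aPos lNeg lPos ν) (hα : α < 1) (haNeg : 0 ≤ aNeg)
    (haPos : 0 ≤ aPos) (hlNeg : 0 < lNeg) (hlPos : 0 < lPos) : MemLp id 2 ν := by
  refine memLp_two_of_charFun_eq_exp_levyExponent hν ?_ ?_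
  · simpa using integrable_abs_rpow_levyMeasure hα haNeg haPos hlNeg hlPos
  · simpa using integrable_abs_rpow_levyMeasure (s := 2) (by linarith) haNeg haPos hlNeg hlPos

theorem IsTemperedStable.eq {ν ν' : Measure ℝ} [IsFiniteMeasure ν] [IsFiniteMeasure ν']
    (hν : IsTemperedStable α aNeg aPos lNeg lPos ν)
    (hν' : IsTemperedStable α aNeg aPos lNeg lPos ν') : ν = ν' :=
  Measure.ext_of_charFun (funext fun t => (hν t).trans (hν' t).symm)

variable {Ω : Type*} [MeasurableSpace Ω] {P : Measure Ω} [IsProbabilityMeasure P] {X Y : Ω → ℝ}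

theorem memLp_two_of_isTemperedStable_map (hX : AEMeasurable X P)
    (hlaw : IsTemperedStable α aNeg aPos lNeg lPos (P.map X)) (hα : α < 1) (haNeg : 0 ≤ aNeg)
    (haPos : 0 ≤ aPos) (hlNeg : 0 < lNeg) (hlPos : 0 < lPos) : MemLp X 2 P := by
  have := Measure.isProbabilityMeasure_map hX
  exact (memLp_map_measure_iff aestronglyMeasurable_id hX).1
    (hlaw.memLp_two hα haNeg haPos hlNeg hlPos)

theorem identDistrib_of_isTemperedStable_map (hX : AEMeasurable X P) (hY : AEMeasurable Y P)
    (hlawX : IsTemperedStable α aNeg aPos lNeg lPos (P.map X))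
    (hlawY : IsTemperedStable α aNeg aPos lNeg lPos (P.map Y)) : IdentDistrib X Y P P :=
  ⟨hX, hY, hlawX.eq hlawY⟩

end TemperedStable

/-! ### Complex combinations of independent tempered stable variables -/

section ComplexCombination

variable {Ω : Type*} [MeasurableSpace Ω] {P : Measure Ω}

theorem iIndepFun_curry {ι κ 𝓧 : Type*} [MeasurableSpace 𝓧] {X : ι × κ → Ω → 𝓧}
    (hX : ∀ q, Measurable (X q)) (hindep : iIndepFun X P) :
    iIndepFun (fun i ω j => X (i, j) ω) P := by
  have := hindep.isProbabilityMeasure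
  have : ∀ i j, IsProbabilityMeasure (P.map (X (i, j))) := fun i j =>
    Measure.isProbabilityMeasure_map (hX _).aemeasurable
  have hrow : ∀ i, P.map (fun ω j => X (i, j) ω) =
      Measure.infinitePi fun j => P.map (X (i, j)) := fun i =>
    (hindep.precomp (Prod.mk_right_injective i)).map_fun_eq_infinitePi_map fun j => hX _
  rw [iIndepFun_iff_map_fun_eq_infinitePi_map (by fun_prop)]
  simp only [hrow]
  rw [← Measure.infinitePi_map_curry fun i j => P.map (X (i, j)),
    ← hindep.map_fun_eq_infinitePi_map hX, Measure.map_map (by fun_prop) (by fun_prop)]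
  rfl

theorem exists_continuousLinearMap_of_mem_partFunctions {φ : ℂ → ℝ} (hφ : φ ∈ partFunctions) :
    ∃ L : ℂ →L[ℝ] ℝ, φ = L := by
  rcases hφ with rfl | rfl | rfl | rfl
  exacts [⟨Complex.reCLM, rfl⟩, ⟨-Complex.reCLM, rfl⟩, ⟨Complex.imCLM, rfl⟩, ⟨-Complex.imCLM, rfl⟩]

variable {θ : Fin 2 → ℕ → Ω → ℝ}

theorem iIndepFun_ofReal_add_I_mul (hθ : ∀ i n, Measurable (θ i n))
    (hindep : iIndepFun (fun q : Fin 2 × ℕ => θ q.1 q.2) P) :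
    iIndepFun (fun n ω => (θ 0 n ω : ℂ) + Complex.I * (θ 1 n ω : ℂ)) P :=
  (iIndepFun_curry (X := fun q : ℕ × Fin 2 => θ q.2 q.1) (fun q => hθ _ _)
    (hindep.precomp Prod.swap_injective)).comp (fun _ v => (v 0 : ℂ) + Complex.I * (v 1 : ℂ))
      fun _ => by fun_prop

theorem identDistrib_ofReal_add_I_mul
    (hindep : iIndepFun (fun q : Fin 2 × ℕ => θ q.1 q.2) P)
    (hident : ∀ i n, IdentDistrib (θ i n) (θ i 0) P P) (n : ℕ) :
    IdentDistrib (fun ω => (θ 0 n ω : ℂ) + Complex.I * (θ 1 n ω : ℂ))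
      (fun ω => (θ 0 0 ω : ℂ) + Complex.I * (θ 1 0 ω : ℂ)) P P := by
  have := hindep.isProbabilityMeasure
  have hpair : ∀ n, IndepFun (θ 0 n) (θ 1 n) P := fun n =>
    hindep.indepFun (i := (0, n)) (j := (1, n)) (by simp)
  exact ((hident 0 n).prodMk (hident 1 n) (hpair n) (hpair 0)).comp
    (u := fun v : ℝ × ℝ => (v.1 : ℂ) + Complex.I * (v.2 : ℂ)) (by fun_prop)

theorem memLp_ofReal_add_I_mul {X Y : Ω → ℝ} {p : ℝ≥0∞} (hX : MemLp X p P) (hY : MemLp Y p P) :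
    MemLp (fun ω => (X ω : ℂ) + Complex.I * (Y ω : ℂ)) p P :=
  (hX.ofReal (K := ℂ)).add ((hY.ofReal (K := ℂ)).const_mul Complex.I)

end ComplexCombination

end TemperedShift

theorem corollary6p6
    -- the parameters
    (α : ℝ) (hα : 0 < α ∧ α < 1)
    (p : ℝ≥0∞) [Fact (1 ≤ p)] (hp : p ≤ 2)
    (aNeg aPos lNeg lPos : ℝ) (haNeg : 0 < aNeg) (haPos : 0 < aPos)
    (hlNeg : 0 < lNeg) (hlPos : 0 < lPos)
    -- the weights, and the coefficients of the random series
    (w : ℕ → ℝ) (hw_pos : ∀ n, 0 < w n) (hw : ∃ C, ∀ n, |w n| ≤ C)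
    (k₀ : ℝ) (hk₀ : 0 < k₀) (hk : Summable fun n => coeff k₀ w n ^ α)
    -- independent tempered stable variables
    {Ω : Type*} [MeasurableSpace Ω] (P : Measure Ω) [IsProbabilityMeasure P]
    (θ : Fin 2 → ℕ → Ω → ℝ) (hθ_meas : ∀ i n, Measurable (θ i n))
    (hθ_indep : iIndepFun (fun q : Fin 2 × ℕ => θ q.1 q.2) P)
    (hθ_law : ∀ i n, IsTemperedStable α aNeg aPos lNeg lPos (P.map (θ i n)))
    -- the Borel structure of `ℓ^p(ℕ)`, the law of the random series, and the shift
    [MeasurableSpace (SeqSpace p)] [BorelSpace (SeqSpace p)]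
    (μ : Measure (SeqSpace p)) (hμ : μ = P.map (randomSeries p (coeff k₀ w) θ))
    (T : SeqSpace p →L[ℂ] SeqSpace p) (hT : T = backwardShift p w hw)
    -- the exponential series
    (a b : ℕ → ℂ) (ha : Summable fun j => ‖a j‖) (hb : Summable fun l => ‖b l‖)
    (haT : Summable fun j : ℕ => ‖a j‖ * ‖T‖ ^ ((j : ℝ) * p.toReal / 2))
    (φ ψ : ℂ → ℝ) (hφ : φ ∈ partFunctions) (hψ : ψ ∈ partFunctions) (hφψ : φ ≠ ψ)
    (xs ys : StrongDual ℂ (SeqSpace p)) :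
    -- the law `μ` is well defined: the random series converges almost surely in `ℓ^p(ℕ)`
    ((∀ᵐ ω ∂P, Summable (seriesTerm p (coeff k₀ w) θ ω)) ∧
      AEMeasurable (randomSeries p (coeff k₀ w) θ) P) ∧
    -- `f` and `g` are well defined, and lie in `L²(μ)`
    (∀ z, Summable fun j => ‖expTerm T φ a xs z j‖) ∧
    (∀ z, Summable fun l => ‖expTerm T ψ b ys z l‖) ∧
    MemLp (expSeries T φ a xs) 2 μ ∧
    MemLp (expSeries T ψ b ys) 2 μ ∧
    -- the rate
    (IsStronglyMixing T μ →
      ∃ C : ℝ, 0 < C ∧ ∀ n : ℕ,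
        ‖correlation T μ n (expSeries T φ a xs) (expSeries T ψ b ys)‖ ≤
          C * ∑' l : ℕ, ‖b l‖ *
            ∑' j : ℕ, coeff k₀ w j ^ (p.toReal / 2) * coeff k₀ w (j + l + n) ^ (p.toReal / 2)) := by
  obtain ⟨L, rfl⟩ := exists_continuousLinearMap_of_mem_partFunctions hφ
  obtain ⟨L', rfl⟩ := exists_continuousLinearMap_of_mem_partFunctions hψ
  have hp_top : p ≠ ∞ := ne_top_of_le_ne_top ENNReal.ofNat_ne_top hp
  have hp_one : 1 ≤ p.toReal := by
    simpa using ENNReal.toReal_mono hp_top (Fact.out : 1 ≤ p)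
  have hkp := summable_rpow_of_le (coeff_nonneg hk₀.le fun n => (hw_pos n).le) hα.1
    (hα.2.le.trans hp_one) hk
  have hident := fun i n => identDistrib_of_isTemperedStable_map (hθ_meas i n).aemeasurable
    (hθ_meas i 0).aemeasurable (hθ_law i n) (hθ_law i 0)
  have hmom := fun i => (memLp_two_of_isTemperedStable_map (hθ_meas i 0).aemeasurable
    (hθ_law i 0) hα.2 haNeg.le haPos.le hlNeg hlPos).mono_exponent hp
  obtain ⟨hseries, hf, hg, hfL, hgL, hrate⟩ := corollary6p6_general hp hk₀.le hw_pos hkp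
    (iIndepFun_ofReal_add_I_mul hθ_meas hθ_indep)
    (identDistrib_ofReal_add_I_mul hθ_indep hident)
    (memLp_ofReal_add_I_mul (hmom 0) (hmom 1)) hμ hT ha hb haT L L' xs ys
  exact ⟨hseries, hf, hg, hfL, hgL, fun _ => hrate⟩
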